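/- Write $\langle x\rangle=\sqrt{1+|x|^2}$, let $\hat N(\xi,\tau)=\iint e^{-i(x\xi+t\tau)}N(x,t)\,dx\,dt$ be the space-time Fourier transform, and let $$\|N\|_{X^{s,b}}=\|\langle\xi\rangle^{s}\langle\tau-\xi^3\rangle^{b}\hat N(\xi,\tau)\|_{L^2_{\xi,\tau}},\qquad \|f\|_{H^\sigma}=\|\langle\tau\rangle^\sigma\hat f(\tau)\|_{L^2_\tau},$$ where $X^{s,b}$ consists of the tempered distributions on $\mathbb R_x\times\mathbb R_t$ whose Fourier transform is a function for which this norm is finite. Let $W^t_{\mathbb R}f=\mathcal F^{-1}[e^{it\xi^3}\hat f(\xi)]$ be the Airy group on $\mathbb R$, and let $\eta\in C^\infty(\mathbb R)$ be real-valued with $\eta=1$ on $[-1,1]$ and $\operatorname{supp}\eta\subset[-2,2]$. For $K>1$ let $R=R_K=\{(\xi,\tau): |\tau|\ge 1 \text{ and } |\tau|\ge K|\xi|^3\}$, with characteristic function $\chi_R$. Let $b'\in(0,\tfrac12)$. For every $s\ge -1$ and $N\in X^{s,-b'}$ the Duhamel term $$D N(x,t)=\eta(t)\int_0^t W^{t-t'}_{\mathbb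 R}[N(\cdot,t')](x)\,dt'$$ is well defined as a tempered distribution, as the continuous extension of $D$ from Schwartz functions to $X^{s,-b'}$ (that is, $N$ is a limit in $X^{s,-b'}$ of Schwartz functions, and for every sequence of Schwartz functions $M_n\to N$ in $X^{s,-b'}$ one has $DM_n\to DN$ as distributions). Moreover: (i) if $-1\le s\le 2-3b'$, there is a constant $C=C(s,b',\eta)$ such that for all $N\in X^{s,-b'}$ $$\|DN\|_{L^\infty_xH^{(s+1)/3}_t}\le C\,\|N\|_{X^{s,-b'}};$$ (ii) if $s>2-3b'$ and $K>1$, there is a constant $C=C(s,b',\eta,K)$ such that for all $N\in X^{s,-b'}$ $$\|DN\|_{L^\infty_xH^{(s+1)/3}_t}\le C\Bigl(\|N\|_{X^{s,-b'}}+\Bigl\|\int\chi_R(\xi,\tau)\,\langle\tau-\xi^3\rangle^{\frac{s-2}{3}}\,|\hat N(\xi,\tau)|\,d\xi\Bigr\|_{L^2_\tau}\Bigr)$$ (the last norm may be infinite). -/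

import Mathlib

open MeasureTheory Filter Topology
open scoped SchwartzMap ENNReal NNReal ContDiff

noncomputable section

namespace AiryHalfLine

/-- The bracket `⟨x⟩ = √(1 + |x|²)`. -/
def jb (x : ℝ) : ℝ := Real.sqrt (1 + |x| ^ 2)

/-- The one-dimensional Fourier transform `∫ e^{-i x ξ} f(x) dx`. -/
def fourier1 (f : ℝ → ℂ) (ξ : ℝ) : ℂ :=
  ∫ x : ℝ, Complex.exp (-Complex.I * x * ξ) * f x

/-- The Airy group on the line: `W_ℝ^t f = 𝓕⁻¹[e^{i t ξ³} 𝓕 f]`. -/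
def airyGroup (t : ℝ) (f : ℝ → ℂ) (x : ℝ) : ℂ :=
  (2 * (Real.pi : ℂ))⁻¹ *
    ∫ ξ : ℝ, Complex.exp (Complex.I * x * ξ) *
      (Complex.exp (Complex.I * t * (ξ : ℂ) ^ 3) * fourier1 f ξ)

/-- The Duhamel term `η(t) ∫₀ᵗ W_ℝ^{t-t'} [M(·,t')](x) dt'` of a Schwartz function `M`,
as a function of `(x, t)`. -/
def duhamel (η : ℝ → ℝ) (M : 𝓢(ℝ × ℝ, ℂ)) (p : ℝ × ℝ) : ℂ :=
  (η p.2 : ℂ) * ∫ t' in (0 : ℝ)..p.2, airyGroup (p.2 - t') (fun y => M (y, t')) p.1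

/-- The space-time Fourier transform `∬ e^{-i(xξ + tτ)} M(x,t) dx dt` of a Schwartz function,
as a function of `(ξ, τ)`. -/
def fourier2 (M : 𝓢(ℝ × ℝ, ℂ)) (q : ℝ × ℝ) : ℂ :=
  ∫ p : ℝ × ℝ, Complex.exp (-Complex.I * (p.1 * q.1 + p.2 * q.2)) * M p

/-- The space-time Fourier transform of the tempered distribution `N` is the function `F` of
`(ξ, τ)`, that is, `N` is the inverse Fourier transform of `F`:
`⟨N, φ⟩ = (2π)⁻² ∬ F(ξ,τ) (∬ e^{i(xξ + tτ)} φ(x,t) dx dt) dξ dτ` for every Schwartz `φ`. -/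
def HasFourier2 (N : 𝓢'(ℝ × ℝ, ℂ)) (F : ℝ × ℝ → ℂ) : Prop :=
  AEStronglyMeasurable F volume ∧
  ∀ φ : 𝓢(ℝ × ℝ, ℂ),
    Integrable (fun q : ℝ × ℝ => F q *
      ∫ p : ℝ × ℝ, Complex.exp (Complex.I * (p.1 * q.1 + p.2 * q.2)) * φ p) ∧
    N φ = ((2 * (Real.pi : ℂ)) ^ 2)⁻¹ *
      ∫ q : ℝ × ℝ, F q *
        ∫ p : ℝ × ℝ, Complex.exp (Complex.I * (p.1 * q.1 + p.2 * q.2)) * φ p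

/-- The `X^{s,b}` norm `‖⟨ξ⟩^s ⟨τ - ξ³⟩^b F(ξ,τ)‖_{L²}` of the distribution with space-time
Fourier transform `F`. -/
def xNorm (s b : ℝ) (F : ℝ × ℝ → ℂ) : ℝ≥0∞ :=
  eLpNorm (fun q : ℝ × ℝ => jb q.1 ^ s * jb (q.2 - q.1 ^ 3) ^ b * ‖F q‖) 2 volume

/-- The Fourier transform in the time variable of the tempered distribution `U` is the function
`g` of `(x, τ)`:
`⟨U, φ⟩ = (2π)⁻¹ ∬ g(x,τ) (∫ e^{i t τ} φ(x,t) dt) dx dτ` for every Schwartz `φ`. -/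
def HasTimeFourier (U : 𝓢'(ℝ × ℝ, ℂ)) (g : ℝ × ℝ → ℂ) : Prop :=
  AEStronglyMeasurable g volume ∧
  ∀ φ : 𝓢(ℝ × ℝ, ℂ),
    Integrable (fun p : ℝ × ℝ => g p *
      ∫ t : ℝ, Complex.exp (Complex.I * t * p.2) * φ (p.1, t)) ∧
    U φ = (2 * (Real.pi : ℂ))⁻¹ *
      ∫ p : ℝ × ℝ, g p * ∫ t : ℝ, Complex.exp (Complex.I * t * p.2) * φ (p.1, t)

/-- The norm of `L^∞_x H^σ_t`: the essential supremum over `x` of the norm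
`‖⟨τ⟩^σ g(x,τ)‖_{L²_τ}`, where `g` is the Fourier transform of `U` in time (unique up to null
sets); it is `∞` when that Fourier transform is not a function. -/
def linftyHNorm (σ : ℝ) (U : 𝓢'(ℝ × ℝ, ℂ)) : ℝ≥0∞ :=
  ⨅ (g : ℝ × ℝ → ℂ) (_ : HasTimeFourier U g),
    essSup (fun x : ℝ => eLpNorm (fun τ : ℝ => jb τ ^ σ * ‖g (x, τ)‖) 2 volume) volume

/-- `M n → N` in `X^{s,b}`, where the `M n` are Schwartz functions and `N` is the distribution
with space-time Fourier transform `F`. -/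
def XTendsto (s b : ℝ) (M : ℕ → 𝓢(ℝ × ℝ, ℂ)) (F : ℝ × ℝ → ℂ) : Prop :=
  Tendsto (fun n => xNorm s b (fun q => F q - fourier2 (M n) q)) atTop (𝓝 0)

/-- `U` is the Duhamel term `η(t) ∫₀ᵗ W_ℝ^{t-t'} N dt'` of the distribution `N ∈ X^{s,b}` with
space-time Fourier transform `F`: the value at `N` of the continuous extension of `duhamel η`
from Schwartz functions to a map from `X^{s,b}` to tempered distributions. -/
def IsDuhamel (s b : ℝ) (η : ℝ → ℝ) (F : ℝ × ℝ → ℂ) (U : 𝓢'(ℝ × ℝ, ℂ)) : Prop :=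
  (∃ M : ℕ → 𝓢(ℝ × ℝ, ℂ), XTendsto s b M F) ∧
  ∀ M : ℕ → 𝓢(ℝ × ℝ, ℂ), XTendsto s b M F →
    ∀ φ : 𝓢(ℝ × ℝ, ℂ),
      Tendsto (fun n => ∫ p : ℝ × ℝ, duhamel η (M n) p * φ p) atTop (𝓝 (U φ))

/-- The region `|τ| ≥ 1`, `|τ| ≫ |ξ|³` of the `(ξ, τ)` plane, where `A ≫ B` means `A ≥ K B`. -/
def regionR (K : ℝ) : Set (ℝ × ℝ) :=
  {q | 1 ≤ |q.2| ∧ K * |q.1| ^ 3 ≤ |q.2|}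

/-- The correction term `‖∫ χ_R(ξ,τ) ⟨τ - ξ³⟩^{(s-2)/3} |F(ξ,τ)| dξ‖_{L²_τ}`. -/
def corrNorm (K s : ℝ) (F : ℝ × ℝ → ℂ) : ℝ≥0∞ :=
  (∫⁻ τ : ℝ, (∫⁻ ξ : ℝ, (regionR K).indicator
    (fun q : ℝ × ℝ =>
      ENNReal.ofReal (jb (q.2 - q.1 ^ 3) ^ ((s - 2) / 3) * ‖F q‖)) (ξ, τ)) ^ 2) ^ (1 / 2 : ℝ)

end AiryHalfLine

end

noncomputable section

namespace AiryHalfLine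

/-! ### The bracket -/

/-! For Schwartz data, Fourier inversion in both variables reduces the Duhamel integral to the time
integral of an exponential. Writing ĥ for the transform of the cutoff, the time Fourier transform of
the Duhamel term is a constant times ∬ e^{ixξ} m(υ,ξ,τ) F(ξ,τ) dξdτ, where m = (ĥ(υ-τ) - ĥ(υ-ξ³)) /
(i(τ-ξ³)). Rapid decay of ĥ, and the mean value inequality where τ-ξ³ is small, bound |m| by
(⟨υ-τ⟩^{-A} + ⟨υ-ξ³⟩^{-A}) ⟨τ-ξ³⟩^{-1} (`exists_norm_duhamelSymbol_le`). After absolute values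
e^{ixξ} disappears, so a single function of υ dominates for every x. Uniformity in x is thus free,
and a weighted L² estimate in υ remains, with σ = (s+1)/3.

The ⟨υ-ξ³⟩ half is controlled for every s (`exists_lintegral_sq_curve`). The ⟨υ-τ⟩ half is a
convolution in τ; Cauchy–Schwarz in ξ reduces it to ∫ ⟨ξ⟩^{-2s} ⟨τ-ξ³⟩^{-(2-2b)} dξ ≲ ⟨τ⟩^{-2σ}.
Here b < 1/2 makes the exponent 2-2b exceed 1, and s ≤ 2-3b is what the values of ξ far from the
cube root of τ require (`exists_lintegral_weight_sub_cube`). For larger s that estimate is used only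
outside R, where |τ| ≲ ⟨ξ⟩³ (`exists_lintegral_weight_compl_regionR`). On R one has ⟨τ⟩ ≲ ⟨τ-ξ³⟩, so
⟨τ⟩^σ ⟨τ-ξ³⟩^{-1} ≲ ⟨τ-ξ³⟩^{(s-2)/3}: this is the correction term (`exists_lintegral_sq_regionR`).

The formula for the time transform makes sense for any F in the space. The case s = -1, where σ = 0,
bounds its pairing with test functions; this defines the distribution and, by linearity, gives
convergence along every approximating Schwartz sequence (`exists_isDuhamel`). Such sequences exist
by density (`exists_xTendsto`). -/

lemma jb_sq (x : ℝ) : jb x ^ 2 = 1 + x ^ 2 := by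
  rw [jb, Real.sq_sqrt (by positivity), sq_abs]

lemma one_le_jb (x : ℝ) : 1 ≤ jb x :=
  Real.one_le_sqrt.2 (by nlinarith [sq_nonneg |x|])

lemma jb_pos (x : ℝ) : 0 < jb x := one_pos.trans_le (one_le_jb x)

lemma jb_nonneg (x : ℝ) : 0 ≤ jb x := (jb_pos x).le

lemma abs_le_jb (x : ℝ) : |x| ≤ jb x :=
  Real.le_sqrt_of_sq_le (by linarith)

lemma jb_neg (x : ℝ) : jb (-x) = jb x := by simp [jb]

lemma jb_sub_comm (x y : ℝ) : jb (x - y) = jb (y - x) := by rw [← jb_neg, neg_sub]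

lemma jb_add_le (x y : ℝ) : jb (x + y) ≤ jb x + |y| := by
  refine Real.sqrt_le_iff.2 ⟨by have := jb_pos x; positivity, ?_⟩
  have h1 := jb_sq x
  have h2 := mul_le_mul_of_nonneg_right (abs_le_jb x) (abs_nonneg y)
  have h3 : x * y ≤ |x| * |y| := by rw [← abs_mul]; exact le_abs_self _
  rw [sq_abs]
  nlinarith [sq_abs y]

lemma jb_le_one_add_abs (x : ℝ) : jb x ≤ 1 + |x| := by
  have := jb_add_le 0 x
  simpa [jb] using this

@[fun_prop]
lemma continuous_jb : Continuous jb := by unfold jb; fun_prop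

@[fun_prop]
lemma measurable_jb : Measurable jb := continuous_jb.measurable

/-- Comparability in both directions is assumed so that the sign of the exponent is irrelevant. -/
lemma rpow_le_of_comparable {x y M : ℝ} (hx : 0 < x) (hy : 0 < y) (hM : 0 < M)
    (h1 : x ≤ M * y) (h2 : y ≤ M * x) (p : ℝ) : x ^ p ≤ M ^ |p| * y ^ p := by
  rcases le_total 0 p with hp | hp
  · rw [abs_of_nonneg hp, ← Real.mul_rpow hM.le hy.le]
    exact Real.rpow_le_rpow hx.le h1 hp
  · rw [abs_of_nonpos hp]
    have h3 : (M * x) ^ p ≤ y ^ p := Real.rpow_le_rpow_of_nonpos hy h2 hp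
    rw [Real.mul_rpow hM.le hx.le] at h3
    rw [Real.rpow_neg hM.le]
    have : 0 < M ^ p := Real.rpow_pos_of_pos hM p
    rw [inv_mul_eq_div, le_div_iff₀ this, mul_comm]
    exact h3

lemma jb_le_two_mul (a b : ℝ) : jb a ≤ 2 * jb (a - b) * jb b := by
  have h := jb_add_le b (a - b)
  rw [add_sub_cancel] at h
  nlinarith [one_le_jb (a - b), one_le_jb b, abs_le_jb (a - b)]

/-- Peetre's inequality. -/
lemma jb_rpow_le (p a b : ℝ) : jb a ^ p ≤ 2 ^ |p| * jb (a - b) ^ |p| * jb b ^ p := by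
  have h := rpow_le_of_comparable (jb_pos a) (jb_pos b)
    (mul_pos two_pos (jb_pos (a - b))) (jb_le_two_mul a b)
    (by rw [jb_sub_comm]; exact jb_le_two_mul b a) p
  rwa [Real.mul_rpow two_pos.le (jb_nonneg _)] at h

lemma jb_cube_le (a : ℝ) : jb (a ^ 3) ≤ jb a ^ 3 := by
  refine Real.sqrt_le_iff.2 ⟨pow_nonneg (jb_nonneg a) 3, ?_⟩
  rw [← pow_mul, mul_comm 3 2, pow_mul, jb_sq, sq_abs]
  nlinarith [sq_nonneg a, sq_nonneg (a ^ 2)]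

lemma le_jb_cube (a : ℝ) : jb a ^ 3 ≤ 2 * jb (a ^ 3) := by
  refine (sq_le_sq₀ (pow_nonneg (jb_nonneg a) 3) (mul_nonneg two_pos.le (jb_nonneg _))).1 ?_
  rw [← pow_mul, mul_comm 3 2, pow_mul, mul_pow, jb_sq, jb_sq]
  have h := sq_nonneg a
  -- With u = a², 4(1+u³) - (1+u)³ = 3(1+u)(u-1)².
  nlinarith [mul_nonneg (add_nonneg zero_le_one h) (sq_nonneg (a ^ 2 - 1))]

lemma jb_cube_rpow_le (p a : ℝ) : jb (a ^ 3) ^ p ≤ 2 ^ |p| * jb a ^ (3 * p) := by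
  have h := rpow_le_of_comparable (jb_pos (a ^ 3)) (pow_pos (jb_pos a) 3) two_pos
    (by nlinarith [jb_cube_le a, jb_pos (a ^ 3)]) (le_jb_cube a) p
  rwa [← Real.rpow_natCast (jb a), ← Real.rpow_mul (jb_nonneg a)] at h

lemma le_jb_cube_rpow (p a : ℝ) : jb a ^ (3 * p) ≤ 2 ^ |p| * jb (a ^ 3) ^ p := by
  have h := rpow_le_of_comparable (pow_pos (jb_pos a) 3) (jb_pos (a ^ 3)) two_pos
    (le_jb_cube a) (by nlinarith [jb_cube_le a, jb_pos (a ^ 3)]) p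
  rwa [← Real.rpow_natCast (jb a), ← Real.rpow_mul (jb_nonneg a)] at h

lemma exists_cube_eq (τ : ℝ) : ∃ a : ℝ, a ^ 3 = τ := by
  have key {t : ℝ} (ht : 0 ≤ t) : (t ^ (1 / 3 : ℝ)) ^ 3 = t := by
    rw [← Real.rpow_natCast, ← Real.rpow_mul ht]; norm_num
  rcases le_total 0 τ with h | h
  · exact ⟨_, key h⟩
  · exact ⟨-(-τ) ^ (1 / 3 : ℝ), by rw [Odd.neg_pow (by decide), key (by linarith), neg_neg]⟩

/-- In the factorization of ξ³ - a³ the quadratic factor is both (ξ+a/2)² + 3a²/4 and (3(ξ+a)² +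
(ξ-a)²)/4. -/
lemma sub_cube_lower (a ξ : ℝ) :
    |ξ - a| * (3 / 4 * a ^ 2) ≤ |a ^ 3 - ξ ^ 3| ∧ |ξ - a| ^ 3 / 4 ≤ |a ^ 3 - ξ ^ 3| := by
  have h : |a ^ 3 - ξ ^ 3| = |ξ - a| * (ξ ^ 2 + ξ * a + a ^ 2) := by
    rw [abs_sub_comm, show ξ ^ 3 - a ^ 3 = (ξ - a) * (ξ ^ 2 + ξ * a + a ^ 2) by ring, abs_mul,
      abs_of_nonneg (a := ξ ^ 2 + ξ * a + a ^ 2)]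
    nlinarith [sq_nonneg (ξ + a / 2), sq_nonneg a]
  rw [h, show |ξ - a| ^ 3 / 4 = |ξ - a| * (|ξ - a| ^ 2 / 4) by ring, sq_abs]
  constructor <;> refine mul_le_mul_of_nonneg_left ?_ (abs_nonneg _)
  · nlinarith [sq_nonneg (ξ + a / 2)]
  · nlinarith [sq_nonneg (ξ + a)]

/-- For τ = a³ the function ⟨τ-ξ³⟩ grows around ξ = a at least on the scale ⟨a⟩^{-2}. In ⟨a⟩²|ξ-a| =
|ξ-a| + a²|ξ-a| the second term is controlled by the linear lower bound, the first by the cubic one,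
which also covers a near 0. -/
lemma jb_sub_cube_lower (a ξ : ℝ) : jb (jb a ^ 2 * (ξ - a)) ≤ 8 * jb (a ^ 3 - ξ ^ 3) := by
  obtain ⟨h1, h2⟩ := sub_cube_lower a ξ
  have h3 := jb_le_one_add_abs (jb a ^ 2 * (ξ - a))
  rw [abs_mul, abs_of_nonneg (sq_nonneg (jb a))] at h3
  have h7 := jb_sq a
  have h4 := abs_le_jb (a ^ 3 - ξ ^ 3)
  have h5 := one_le_jb (a ^ 3 - ξ ^ 3)
  have h6 : |ξ - a| ≤ 1 + |ξ - a| ^ 3 / 4 := by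
    nlinarith [sq_nonneg (|ξ - a| - 2), abs_nonneg (ξ - a),
      mul_nonneg (abs_nonneg (ξ - a)) (sq_nonneg (|ξ - a| - 2)), sq_nonneg (|ξ - a| - 1)]
  have h8 : jb a ^ 2 * |ξ - a| = |ξ - a| + 4 / 3 * (|ξ - a| * (3 / 4 * a ^ 2)) := by
    rw [h7]; ring
  linarith

/-! ### Weights as extended nonnegative reals -/

/-- The weight `⟨x⟩^p` with values in `[0, ∞]`. -/
def jbw (p x : ℝ) : ℝ≥0∞ := ENNReal.ofReal (jb x ^ p)

lemma jbw_mul (p q x : ℝ) : jbw p x * jbw q x = jbw (p + q) x := by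
  rw [jbw, jbw, jbw, ← ENNReal.ofReal_mul (Real.rpow_nonneg (jb_nonneg x) p),
    Real.rpow_add (jb_pos x)]

lemma jbw_sub_comm (p x y : ℝ) : jbw p (x - y) = jbw p (y - x) := by
  rw [jbw, jbw, jb_sub_comm]

lemma jbw_zero (x : ℝ) : jbw 0 x = 1 := by simp [jbw]

lemma jbw_ne_top (p x : ℝ) : jbw p x ≠ ⊤ := ENNReal.ofReal_ne_top

lemma jbw_pow_two (p x : ℝ) : jbw p x ^ 2 = jbw (2 * p) x := by
  rw [sq, jbw_mul, two_mul]

@[fun_prop]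
lemma measurable_jbw (p : ℝ) : Measurable (jbw p) := by unfold jbw; fun_prop

lemma lintegral_jbw_lt_top {β : ℝ} (hβ : 1 < β) : ∫⁻ x, jbw (-β) x < ⊤ := by
  have h : Integrable (fun x : ℝ => ((1 : ℝ) + ‖x‖ ^ 2) ^ (-β / 2)) :=
    integrable_rpow_neg_one_add_norm_sq (by simpa using hβ)
  have h2 := h.lintegral_lt_top
  refine lt_of_eq_of_lt (lintegral_congr fun x => ?_) h2
  rw [jbw, jb, Real.norm_eq_abs, Real.sqrt_eq_rpow, ← Real.rpow_mul (by positivity)]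
  congr 2; ring

lemma exists_lintegral_jbw {β : ℝ} (hβ : 1 < β) : ∃ C : ℝ≥0, ∫⁻ x, jbw (-β) x = C :=
  ⟨_, (ENNReal.coe_toNNReal (lintegral_jbw_lt_top hβ).ne).symm⟩

lemma lintegral_jbw_affine (β a : ℝ) {r : ℝ} (hr : 0 < r) :
    ∫⁻ x, jbw (-β) (r * (x - a)) = ENNReal.ofReal r⁻¹ * ∫⁻ x, jbw (-β) x := by
  rw [lintegral_sub_right_eq_self (fun x => jbw (-β) (r * x)) a]
  have := Real.map_volume_mul_left hr.ne'
  have h2 := lintegral_map (μ := volume) (measurable_jbw (-β)) (measurable_const_mul r)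
  rw [← h2, this, lintegral_smul_measure, abs_of_pos (inv_pos.2 hr), smul_eq_mul]

/-- Convolution of a weight with a rapidly decreasing weight. -/
lemma exists_lintegral_conv_jbw {A p : ℝ} (hA : |p| + 2 ≤ A) : ∃ C : ℝ≥0, ∀ υ : ℝ,
    ∫⁻ τ, jbw (-A) (υ - τ) * jbw p τ ≤ C * jbw p υ := by
  obtain ⟨C, hC⟩ := exists_lintegral_jbw (β := 2) one_lt_two
  refine ⟨(Real.toNNReal (2 ^ |p|)) * C, fun υ => ?_⟩
  have hp (τ : ℝ) : jbw (-A) (υ - τ) * jbw p τ ≤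
      (ENNReal.ofReal (2 ^ |p|) * jbw p υ) * jbw (-2) (τ - υ) := by
    rw [jbw_sub_comm (-A)]
    simp only [jbw]
    rw [← ENNReal.ofReal_mul (by have := jb_pos (τ - υ); positivity),
      ← ENNReal.ofReal_mul (by positivity),
      ← ENNReal.ofReal_mul (by have := jb_pos υ; positivity)]
    refine ENNReal.ofReal_le_ofReal ?_
    have h1 := jb_rpow_le p τ υ
    have hpos := jb_pos (τ - υ)
    have hpos' := jb_pos υ
    -- Moving the weight from τ to υ costs |p| powers of decay; the two that are left keep the
    -- integral finite.
    have h2 : jb (τ - υ) ^ (-A) * jb (τ - υ) ^ |p| ≤ jb (τ - υ) ^ (-2 : ℝ) := by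
      rw [← Real.rpow_add hpos]
      exact Real.rpow_le_rpow_of_exponent_le (one_le_jb _) (by linarith)
    calc _ ≤ jb (τ - υ) ^ (-A) * (2 ^ |p| * jb (τ - υ) ^ |p| * jb υ ^ p) := by gcongr
      _ = 2 ^ |p| * jb υ ^ p * (jb (τ - υ) ^ (-A) * jb (τ - υ) ^ |p|) := by ring
      _ ≤ _ := by gcongr
  calc _ ≤ ∫⁻ τ, (ENNReal.ofReal (2 ^ |p|) * jbw p υ) * jbw (-2) (τ - υ) := lintegral_mono hp
    _ = (ENNReal.ofReal (2 ^ |p|) * jbw p υ) * C := by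
      rw [lintegral_const_mul' _ _ (ENNReal.mul_ne_top ENNReal.ofReal_ne_top (jbw_ne_top _ _)),
        lintegral_sub_right_eq_self (fun x => jbw (-2) x) υ, hC]
    _ = _ := by
      rw [ENNReal.ofReal]; push_cast; ring

/-! ### Weighted integrals over cubic level sets -/

lemma jb_sub_cube_rpow_le {β : ℝ} (hβ : 0 ≤ β) (a ξ : ℝ) :
    jb (a ^ 3 - ξ ^ 3) ^ (-β) ≤ 8 ^ β * jb (jb a ^ 2 * (ξ - a)) ^ (-β) := by
  have h := Real.rpow_le_rpow_of_nonpos (jb_pos _) (jb_sub_cube_lower a ξ) (neg_nonpos.2 hβ)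
  rw [Real.mul_rpow (by norm_num) (jb_nonneg _), Real.rpow_neg (by norm_num),
    inv_mul_eq_div, div_le_iff₀ (by positivity), mul_comm] at h
  exact h

/-- Rescaling by ⟨a⟩² gains ⟨a⟩^{-2}, and ⟨a⟩^{p-2} is comparable to ⟨a³⟩^{(p-2)/3}. -/
lemma exists_lintegral_near {β : ℝ} (hβ : 1 < β) (p : ℝ) : ∃ C : ℝ≥0, ∀ a : ℝ,
    ∫⁻ ξ, ENNReal.ofReal (jb a ^ p * jb (jb a ^ 2 * (ξ - a)) ^ (-β)) ≤
      C * jbw ((p - 2) / 3) (a ^ 3) := by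
  obtain ⟨C, hC⟩ := exists_lintegral_jbw hβ
  refine ⟨C * Real.toNNReal (2 ^ |(p - 2) / 3|), fun a => ?_⟩
  have hpos := jb_pos a
  have h1 (ξ : ℝ) : ENNReal.ofReal (jb a ^ p * jb (jb a ^ 2 * (ξ - a)) ^ (-β)) =
      jbw p a * jbw (-β) (jb a ^ 2 * (ξ - a)) := by
    rw [jbw, jbw, ENNReal.ofReal_mul (by positivity)]
  simp_rw [h1]
  rw [lintegral_const_mul' _ _ (jbw_ne_top _ _), lintegral_jbw_affine β a (pow_pos hpos 2), hC,
    ← mul_assoc, mul_comm, jbw, ← ENNReal.ofReal_mul (by positivity)]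
  rw [ENNReal.coe_mul, mul_assoc]
  refine mul_le_mul_right ?_ _
  rw [jbw, ← ENNReal.ofReal, ← ENNReal.ofReal_mul (by positivity)]
  refine ENNReal.ofReal_le_ofReal ?_
  have h2 := le_jb_cube_rpow ((p - 2) / 3) a
  rw [show 3 * ((p - 2) / 3) = p - 2 by ring, Real.rpow_sub hpos] at h2
  simpa [div_eq_mul_inv] using h2

/-- The integral of `⟨τ - ξ³⟩^{-β}` over `ξ`. -/
lemma exists_lintegral_sub_cube {β : ℝ} (hβ : 1 < β) : ∃ C : ℝ≥0, ∀ τ : ℝ,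
    ∫⁻ ξ, jbw (-β) (τ - ξ ^ 3) ≤ C * jbw (-2 / 3) τ := by
  obtain ⟨C, hC⟩ := exists_lintegral_near hβ 0
  refine ⟨Real.toNNReal (8 ^ β) * C, fun τ => ?_⟩
  obtain ⟨a, rfl⟩ := exists_cube_eq τ
  calc _ ≤ ∫⁻ ξ, ENNReal.ofReal (8 ^ β) *
        ENNReal.ofReal (jb a ^ (0 : ℝ) * jb (jb a ^ 2 * (ξ - a)) ^ (-β)) := by
        refine lintegral_mono fun ξ => ?_
        rw [← ENNReal.ofReal_mul (by positivity), Real.rpow_zero, one_mul]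
        exact ENNReal.ofReal_le_ofReal (jb_sub_cube_rpow_le (by linarith) a ξ)
    _ ≤ ENNReal.ofReal (8 ^ β) * (C * jbw (-2 / 3) (a ^ 3)) := by
        rw [lintegral_const_mul' _ _ ENNReal.ofReal_ne_top]
        have := hC a
        rw [zero_sub] at this
        gcongr
    _ = _ := by rw [ENNReal.ofReal]; push_cast; ring

/-- Far from a, both ⟨a⟩³ and ⟨ξ⟩³ are at most a constant times ⟨a³-ξ³⟩. The decay exponent β is
split: (2s+2)/3 is spent on ⟨a⟩, the rest on ⟨ξ⟩. The two hypotheses on s say exactly that both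
shares are nonnegative. For β > 1 the remaining power 2-3β of ⟨ξ⟩ is integrable. -/
lemma jb_far_bound {s β : ℝ} (hs : -1 ≤ s) (hs' : 2 * s + 2 ≤ 3 * β) (a ξ : ℝ)
    (h : jb a / 2 < |ξ - a|) :
    jb ξ ^ (-2 * s) * jb (a ^ 3 - ξ ^ 3) ^ (-β) ≤
      108 ^ β * (jb a ^ (-2 * s - 2) * jb ξ ^ (2 - 3 * β)) := by
  have ha := jb_pos a
  have hξ := jb_pos ξ
  set J := jb (a ^ 3 - ξ ^ 3)
  have hJ : 0 < J := jb_pos _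
  have h2 : |ξ - a| ^ 3 / 4 ≤ J := (sub_cube_lower a ξ).2.trans (abs_le_jb _)
  have h3 : jb ξ ≤ 3 * |ξ - a| := by
    have := jb_add_le a (ξ - a)
    rw [add_sub_cancel] at this
    linarith
  have h4 : jb a ≤ 3 * |ξ - a| := by linarith [abs_nonneg (ξ - a)]
  have key (y θ : ℝ) (hy : 0 < y) (hyd : y ≤ 3 * |ξ - a|) (hθ : 0 ≤ θ) :
      J ^ (-θ) ≤ 108 ^ θ * y ^ (-(3 * θ)) := by
    -- 108 = 3³ · 4, the 4 coming from the cubic lower bound.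
    have h5 : y ^ 3 ≤ 108 * J := by
      have : y ^ 3 ≤ (3 * |ξ - a|) ^ 3 := by gcongr
      nlinarith
    have h6 := Real.rpow_le_rpow_of_nonpos (pow_pos hy 3) h5 (neg_nonpos.2 hθ)
    rw [Real.mul_rpow (by norm_num) hJ.le, Real.rpow_neg (by norm_num), inv_mul_eq_div,
      div_le_iff₀ (by positivity), ← Real.rpow_natCast y, ← Real.rpow_mul hy.le] at h6
    rw [mul_comm]
    rw [show -(3 * θ) = ((3 : ℕ) : ℝ) * -θ by push_cast; ring]
    exact h6
  have k1 := key (jb a) ((2 * s + 2) / 3) ha h4 (by linarith)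
  have k2 := key (jb ξ) (β - (2 * s + 2) / 3) hξ h3 (by linarith)
  have e1 : J ^ (-β) = J ^ (-((2 * s + 2) / 3)) * J ^ (-(β - (2 * s + 2) / 3)) := by
    rw [← Real.rpow_add hJ]; congr 1; ring
  have e2 : (108 : ℝ) ^ β = 108 ^ ((2 * s + 2) / 3) * 108 ^ (β - (2 * s + 2) / 3) := by
    rw [← Real.rpow_add (by norm_num)]; congr 1; ring
  have e3 : jb ξ ^ (2 - 3 * β) = jb ξ ^ (-2 * s) * jb ξ ^ (-(3 * (β - (2 * s + 2) / 3))) := by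
    rw [← Real.rpow_add hξ]; congr 1; ring
  have e4 : jb a ^ (-2 * s - 2) = jb a ^ (-(3 * ((2 * s + 2) / 3))) := by
    congr 1; ring
  rw [e1, e2, e3, e4]
  calc _ ≤ jb ξ ^ (-2 * s) * ((108 ^ ((2 * s + 2) / 3) * jb a ^ (-(3 * ((2 * s + 2) / 3)))) *
        (108 ^ (β - (2 * s + 2) / 3) * jb ξ ^ (-(3 * (β - (2 * s + 2) / 3))))) := by gcongr
    _ = _ := by ring

/-- Here ⟨ξ⟩ and ⟨a⟩ agree up to a factor 2, so the weight in ξ can be frozen at a. -/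
lemma jb_near_bound {β : ℝ} (hβ : 0 ≤ β) (s a ξ : ℝ) (h : |ξ - a| ≤ jb a / 2) :
    jb ξ ^ (-2 * s) * jb (a ^ 3 - ξ ^ 3) ^ (-β) ≤
      2 ^ |(-2 * s)| * 8 ^ β * (jb a ^ (-2 * s) * jb (jb a ^ 2 * (ξ - a)) ^ (-β)) := by
  have h1 := jb_add_le a (ξ - a)
  have h2 := jb_add_le ξ (a - ξ)
  rw [add_sub_cancel] at h1 h2
  rw [abs_sub_comm] at h2
  have h3 := rpow_le_of_comparable (jb_pos ξ) (jb_pos a) two_pos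
    (by linarith [jb_pos a]) (by linarith) (-2 * s)
  have h4 := jb_sub_cube_rpow_le hβ a ξ
  have := jb_pos a
  have := jb_pos (a ^ 3 - ξ ^ 3)
  calc _ ≤ (2 ^ |(-2 * s)| * jb a ^ (-2 * s)) * (8 ^ β * jb (jb a ^ 2 * (ξ - a)) ^ (-β)) := by
        gcongr
    _ = _ := by ring

/-- The integral of `⟨ξ⟩^{-2s} ⟨τ - ξ³⟩^{-β}` over `ξ`. -/
lemma exists_lintegral_weight_sub_cube {s β : ℝ} (hβ : 1 < β) (hs : -1 ≤ s)
    (hs' : 2 * s + 2 ≤ 3 * β) : ∃ C : ℝ≥0, ∀ τ : ℝ,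
    ∫⁻ ξ, jbw (-2 * s) ξ * jbw (-β) (τ - ξ ^ 3) ≤ C * jbw (-2 * ((s + 1) / 3)) τ := by
  obtain ⟨C, hC⟩ := exists_lintegral_near hβ (-2 * s)
  obtain ⟨C', hC'⟩ := exists_lintegral_jbw (β := 3 * β - 2) (by linarith)
  set M := Real.toNNReal (2 ^ |(-2 * s)| * 8 ^ β)
  set M' := Real.toNNReal (108 ^ β)
  set M'' := Real.toNNReal (2 ^ |-2 * ((s + 1) / 3)|)
  refine ⟨M * C + M' * M'' * C', fun τ => ?_⟩
  obtain ⟨a, rfl⟩ := exists_cube_eq τ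
  have ha := jb_pos a
  have hpt (ξ : ℝ) : jbw (-2 * s) ξ * jbw (-β) (a ^ 3 - ξ ^ 3) ≤
      M * ENNReal.ofReal (jb a ^ (-2 * s) * jb (jb a ^ 2 * (ξ - a)) ^ (-β)) +
        (M' * jbw (-2 * s - 2) a) * jbw (-(3 * β - 2)) ξ := by
    rw [jbw, jbw, ← ENNReal.ofReal_mul (by have := jb_pos ξ; positivity)]
    rcases le_or_gt |ξ - a| (jb a / 2) with h | h
    · refine le_add_of_le_of_nonneg ?_ zero_le
      rw [← ENNReal.ofReal, ← ENNReal.ofReal_mul (by positivity)]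
      exact ENNReal.ofReal_le_ofReal (jb_near_bound (by linarith) s a ξ h)
    · refine le_add_of_nonneg_of_le zero_le ?_
      rw [← ENNReal.ofReal, jbw, jbw, mul_assoc, ← ENNReal.ofReal_mul (by positivity),
        ← ENNReal.ofReal_mul (by positivity), neg_sub]
      exact ENNReal.ofReal_le_ofReal (jb_far_bound hs hs' a ξ h)
  have ha3 : jbw (-2 * s - 2) a ≤ M'' * jbw (-2 * ((s + 1) / 3)) (a ^ 3) := by
    rw [← ENNReal.ofReal, jbw, jbw, ← ENNReal.ofReal_mul (by positivity)]
    refine ENNReal.ofReal_le_ofReal ?_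
    have := le_jb_cube_rpow (-2 * ((s + 1) / 3)) a
    rwa [show 3 * (-2 * ((s + 1) / 3)) = -2 * s - 2 by ring] at this
  calc _ ≤ ∫⁻ ξ, (M * ENNReal.ofReal (jb a ^ (-2 * s) * jb (jb a ^ 2 * (ξ - a)) ^ (-β)) +
        (M' * jbw (-2 * s - 2) a) * jbw (-(3 * β - 2)) ξ) := lintegral_mono hpt
    _ ≤ M * (C * jbw (-2 * ((s + 1) / 3)) (a ^ 3)) +
        (M' * (M'' * jbw (-2 * ((s + 1) / 3)) (a ^ 3))) * C' := by
      rw [lintegral_add_right _ (by fun_prop), lintegral_const_mul' _ _ ENNReal.coe_ne_top,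
        lintegral_const_mul' _ _ (ENNReal.mul_ne_top ENNReal.coe_ne_top (jbw_ne_top _ _)), hC']
      have := hC a
      rw [show (-2 * s - 2) / 3 = -2 * ((s + 1) / 3) by ring] at this
      gcongr
    _ = _ := by push_cast; ring

/-- The integral of `⟨ξ⟩^{-2s} ⟨τ - ξ³⟩^{-β}` over the `ξ` with `(ξ, τ)` outside `regionR K`. -/
lemma exists_lintegral_weight_compl_regionR {s β K : ℝ} (hβ : 1 < β) (hs : 0 ≤ s) (hK : 1 < K) :
    ∃ C : ℝ≥0, ∀ τ : ℝ,
    ∫⁻ ξ, (regionR K)ᶜ.indicator (fun q => jbw (-2 * s) q.1 * jbw (-β) (q.2 - q.1 ^ 3)) (ξ, τ) ≤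
      C * jbw (-2 * ((s + 1) / 3)) τ := by
  obtain ⟨C, hC⟩ := exists_lintegral_sub_cube hβ
  set M := (4 * K) ^ (2 * s / 3)
  have hM : 0 ≤ M := by positivity
  refine ⟨Real.toNNReal M * C, fun τ => ?_⟩
  have hpt (ξ : ℝ) : (regionR K)ᶜ.indicator
      (fun q => jbw (-2 * s) q.1 * jbw (-β) (q.2 - q.1 ^ 3)) (ξ, τ) ≤
        (Real.toNNReal M * jbw (-2 * s / 3) τ) * jbw (-β) (τ - ξ ^ 3) := by
    refine Set.indicator_apply_le' (fun hq => ?_) fun _ => zero_le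
    refine mul_le_mul_left ?_ _
    rw [← ENNReal.ofReal, jbw, jbw, ← ENNReal.ofReal_mul hM]
    refine ENNReal.ofReal_le_ofReal ?_
    have hτ := jb_pos τ
    have hξ := jb_pos ξ
    -- Outside the region either |τ| < 1 or |τ| < K|ξ|³, and K > 1 lets one constant serve both
    -- cases. Since s ≥ 0, the weight ⟨ξ⟩^{-2s} is then dominated by ⟨τ⟩^{-2s/3} and leaves the
    -- ξ-integral.
    have h1 : jb τ ≤ 4 * K * jb ξ ^ 3 := by
      have h2 := jb_le_one_add_abs τ
      have h3 : 1 ≤ jb ξ ^ 3 := one_le_pow₀ (one_le_jb ξ)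
      have h4 : |ξ| ^ 3 ≤ jb ξ ^ 3 := by gcongr; exact abs_le_jb ξ
      simp only [regionR, Set.mem_compl_iff, Set.mem_ofPred_eq, not_and_or, not_le] at hq
      rcases hq with hq | hq <;> nlinarith
    have h5 := Real.rpow_le_rpow hτ.le h1 (show 0 ≤ 2 * s / 3 by positivity)
    rw [Real.mul_rpow (by positivity) (by positivity), ← Real.rpow_natCast (jb ξ),
      ← Real.rpow_mul hξ.le, show ((3 : ℕ) : ℝ) * (2 * s / 3) = 2 * s by push_cast; ring] at h5
    rw [show -2 * s / 3 = -(2 * s / 3) by ring, neg_mul, Real.rpow_neg hτ.le, Real.rpow_neg hξ.le,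
      ← div_eq_mul_inv, le_div_iff₀ (by positivity), inv_mul_eq_div, div_le_iff₀ (by positivity)]
    exact h5
  calc _ ≤ ∫⁻ ξ, (Real.toNNReal M * jbw (-2 * s / 3) τ) * jbw (-β) (τ - ξ ^ 3) :=
        lintegral_mono hpt
    _ ≤ (Real.toNNReal M * jbw (-2 * s / 3) τ) * (C * jbw (-2 / 3) τ) := by
      rw [lintegral_const_mul' _ _ (ENNReal.mul_ne_top ENNReal.coe_ne_top (jbw_ne_top _ _))]
      gcongr
      exact hC τ
    _ = Real.toNNReal M * C * (jbw (-2 * s / 3) τ * jbw (-2 / 3) τ) := by ring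
    _ = _ := by
      rw [jbw_mul, show -2 * s / 3 + -2 / 3 = -2 * ((s + 1) / 3) by ring]; push_cast; rfl

/-! ### Weighted `L²` bounds for the absolute Duhamel kernel -/

lemma lintegral_mul_sq_le {α : Type*} [MeasurableSpace α] {μ : Measure α} {u v : α → ℝ≥0∞}
    (hu : AEMeasurable u μ) (hv : AEMeasurable v μ) :
    (∫⁻ x, u x * v x ∂μ) ^ 2 ≤ (∫⁻ x, u x ^ 2 ∂μ) * ∫⁻ x, v x ^ 2 ∂μ := by
  have h := ENNReal.lintegral_mul_le_Lp_mul_Lq μ Real.HolderConjugate.two_two hu hv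
  have h2 := pow_le_pow_left' h 2
  rw [mul_pow, ← ENNReal.rpow_natCast, ← ENNReal.rpow_natCast, ← ENNReal.rpow_natCast,
    ← ENNReal.rpow_mul, ← ENNReal.rpow_mul] at h2
  simpa using h2

lemma ennreal_add_sq_le (a b : ℝ≥0∞) : (a + b) ^ 2 ≤ 2 * (a ^ 2 + b ^ 2) := by
  have h := ENNReal.rpow_add_le_mul_rpow_add_rpow a b (p := 2) one_le_two
  norm_num at h
  exact h

/-- The weighted `L²` norm of a convolution with a rapidly decreasing weight. -/
lemma exists_lintegral_sq_conv {A p : ℝ} (hA : |p| + 2 ≤ A) : ∃ C : ℝ≥0,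
    ∀ k : ℝ → ℝ≥0∞, Measurable k →
      ∫⁻ υ, jbw p υ * (∫⁻ τ, jbw (-A) (υ - τ) * k τ) ^ 2 ≤ C * ∫⁻ τ, jbw p τ * k τ ^ 2 := by
  obtain ⟨C₁, hC₁⟩ := exists_lintegral_conv_jbw (A := A) (p := -p) (by rwa [abs_neg])
  obtain ⟨C₂, hC₂⟩ := exists_lintegral_conv_jbw (A := A) (p := 0)
    (by rw [abs_zero]; linarith [abs_nonneg p])
  refine ⟨C₁ * C₂, fun k hk => ?_⟩
  have h1 (υ : ℝ) : jbw p υ * (∫⁻ τ, jbw (-A) (υ - τ) * k τ) ^ 2 ≤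
      C₁ * ∫⁻ τ, jbw (-A) (υ - τ) * (jbw p τ * k τ ^ 2) := by
    -- Schur-type argument: Cauchy–Schwarz for the measure ⟨υ-τ⟩^{-A} dτ with 1 = ⟨τ⟩^{-p/2}
    -- ⟨τ⟩^{p/2}. The first factor is ≲ ⟨υ⟩^{-p}, which cancels the outer weight.
    have h2 := lintegral_mul_sq_le (μ := volume)
      (u := fun τ => jbw (-A / 2) (υ - τ) * jbw (-p / 2) τ)
      (v := fun τ => jbw (-A / 2) (υ - τ) * (jbw (p / 2) τ * k τ))
      (by fun_prop) (by fun_prop)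
    have e1 (τ : ℝ) : jbw (-A / 2) (υ - τ) * jbw (-p / 2) τ *
        (jbw (-A / 2) (υ - τ) * (jbw (p / 2) τ * k τ)) = jbw (-A) (υ - τ) * k τ := by
      calc _ = (jbw (-A / 2) (υ - τ) * jbw (-A / 2) (υ - τ)) *
            (jbw (-p / 2) τ * jbw (p / 2) τ) * k τ := by ring
        _ = _ := by
          rw [jbw_mul, jbw_mul, show -p / 2 + p / 2 = 0 by ring, jbw_zero, mul_one, add_halves]
    have e2 (τ : ℝ) : (jbw (-A / 2) (υ - τ) * jbw (-p / 2) τ) ^ 2 =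
        jbw (-A) (υ - τ) * jbw (-p) τ := by
      rw [mul_pow, jbw_pow_two, jbw_pow_two, mul_div_cancel₀ _ two_ne_zero,
        mul_div_cancel₀ _ two_ne_zero]
    have e3 (τ : ℝ) : (jbw (-A / 2) (υ - τ) * (jbw (p / 2) τ * k τ)) ^ 2 =
        jbw (-A) (υ - τ) * (jbw p τ * k τ ^ 2) := by
      rw [mul_pow, mul_pow, jbw_pow_two, jbw_pow_two, mul_div_cancel₀ _ two_ne_zero,
        mul_div_cancel₀ _ two_ne_zero]
    simp_rw [e1, e2, e3] at h2
    calc _ ≤ jbw p υ * ((C₁ * jbw (-p) υ) * ∫⁻ τ, jbw (-A) (υ - τ) * (jbw p τ * k τ ^ 2)) := by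
          gcongr
          exact h2.trans (mul_le_mul_left (hC₁ υ) _)
      _ = (jbw p υ * jbw (-p) υ) * (C₁ * ∫⁻ τ, jbw (-A) (υ - τ) * (jbw p τ * k τ ^ 2)) := by ring
      _ = _ := by rw [jbw_mul, add_neg_cancel, jbw_zero, one_mul]
  calc _ ≤ ∫⁻ υ, C₁ * ∫⁻ τ, jbw (-A) (υ - τ) * (jbw p τ * k τ ^ 2) := lintegral_mono h1
    _ = C₁ * ∫⁻ τ, ∫⁻ υ, jbw (-A) (υ - τ) * (jbw p τ * k τ ^ 2) := by
      rw [lintegral_const_mul' _ _ ENNReal.coe_ne_top, lintegral_lintegral_swap]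
      fun_prop
    _ ≤ C₁ * ∫⁻ τ, C₂ * (jbw p τ * k τ ^ 2) := by
      gcongr with τ
      rw [lintegral_mul_const _ (by fun_prop)]
      gcongr
      have := hC₂ τ
      simp_rw [jbw_zero, mul_one, jbw_sub_comm _ τ] at this
      exact this
    _ = _ := by
      rw [lintegral_const_mul' _ _ ENNReal.coe_ne_top, ENNReal.coe_mul, mul_assoc]

/-- The square of the `X^{s,-b}` norm of a nonnegative function. -/
def energy (s b : ℝ) (f : ℝ × ℝ → ℝ≥0∞) : ℝ≥0∞ :=
  ∫⁻ q, jbw (2 * s) q.1 * jbw (-2 * b) (q.2 - q.1 ^ 3) * f q ^ 2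

/-- The `ξ`-integral of `f(ξ,τ) / ⟨τ - ξ³⟩` over the section of `S`. -/
def lineIntegral (S : Set (ℝ × ℝ)) (f : ℝ × ℝ → ℝ≥0∞) (τ : ℝ) : ℝ≥0∞ :=
  ∫⁻ ξ, S.indicator (fun q => jbw (-1) (q.2 - q.1 ^ 3) * f q) (ξ, τ)

lemma measurable_lineIntegral {S : Set (ℝ × ℝ)} (hS : MeasurableSet S) {f : ℝ × ℝ → ℝ≥0∞}
    (hf : Measurable f) : Measurable (lineIntegral S f) :=
  Measurable.lintegral_prod_left'
    (f := S.indicator fun q : ℝ × ℝ => jbw (-1) (q.2 - q.1 ^ 3) * f q)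
    (Measurable.indicator (by fun_prop) hS)

lemma setLIntegral_line (A υ : ℝ) {S : Set (ℝ × ℝ)} (hS : MeasurableSet S)
    {f : ℝ × ℝ → ℝ≥0∞} (hf : Measurable f) :
    ∫⁻ q in S, jbw (-A) (υ - q.2) * jbw (-1) (q.2 - q.1 ^ 3) * f q =
      ∫⁻ τ, jbw (-A) (υ - τ) * lineIntegral S f τ := by
  rw [← lintegral_indicator hS, Measure.volume_eq_prod, lintegral_prod_symm' _
    (Measurable.indicator (by fun_prop) hS)]
  refine lintegral_congr fun τ => ?_
  rw [lineIntegral, ← lintegral_const_mul' _ _ (jbw_ne_top _ _)]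
  refine lintegral_congr fun ξ => ?_
  by_cases hq : (ξ, τ) ∈ S <;> simp [hq, mul_assoc]

/-- The convolution in τ preserves weighted L², so only the ξ-integral matters. Cauchy–Schwarz
splits ⟨τ-ξ³⟩^{-1} as ⟨τ-ξ³⟩^{b-1} ⟨τ-ξ³⟩^{-b}: the second part goes with f into the energy, the
first gives the integral in `h`. The set S is kept general in order to serve both the whole plane
and the complement of `regionR K`. -/
lemma exists_lintegral_sq_line {A s b : ℝ} (S : Set (ℝ × ℝ)) (hS : MeasurableSet S)
    (hA : |2 * ((s + 1) / 3)| + 2 ≤ A) {C₀ : ℝ≥0}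
    (h : ∀ τ, ∫⁻ ξ, S.indicator
      (fun q => jbw (-2 * s) q.1 * jbw (-(2 - 2 * b)) (q.2 - q.1 ^ 3)) (ξ, τ) ≤
        C₀ * jbw (-2 * ((s + 1) / 3)) τ) :
    ∃ C : ℝ≥0, ∀ f : ℝ × ℝ → ℝ≥0∞, Measurable f →
      ∫⁻ υ, jbw (2 * ((s + 1) / 3)) υ * (∫⁻ q in S,
        jbw (-A) (υ - q.2) * jbw (-1) (q.2 - q.1 ^ 3) * f q) ^ 2 ≤ C * energy s b f := by
  obtain ⟨C, hC⟩ := exists_lintegral_sq_conv hA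
  refine ⟨C * C₀, fun f hf => ?_⟩
  set σ := (s + 1) / 3
  have h2 (τ : ℝ) : jbw (2 * σ) τ * lineIntegral S f τ ^ 2 ≤
      C₀ * ∫⁻ ξ, jbw (2 * s) ξ * jbw (-2 * b) (τ - ξ ^ 3) * f (ξ, τ) ^ 2 := by
    have h3 := lintegral_mul_sq_le (μ := volume)
      (u := fun ξ => S.indicator (fun q => jbw (-s) q.1 * jbw (b - 1) (q.2 - q.1 ^ 3)) (ξ, τ))
      (v := fun ξ => jbw s ξ * jbw (-b) (τ - ξ ^ 3) * f (ξ, τ))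
      (Measurable.comp (Measurable.indicator (f := fun q : ℝ × ℝ =>
        jbw (-s) q.1 * jbw (b - 1) (q.2 - q.1 ^ 3)) (by fun_prop) hS)
        measurable_prodMk_right).aemeasurable
      (by fun_prop)
    have e1 (ξ : ℝ) : S.indicator (fun q => jbw (-s) q.1 * jbw (b - 1) (q.2 - q.1 ^ 3)) (ξ, τ) *
        (jbw s ξ * jbw (-b) (τ - ξ ^ 3) * f (ξ, τ)) =
        S.indicator (fun q => jbw (-1) (q.2 - q.1 ^ 3) * f q) (ξ, τ) := by
      by_cases hq : (ξ, τ) ∈ S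
      · simp only [Set.indicator_of_mem hq]
        calc _ = (jbw (-s) ξ * jbw s ξ) * (jbw (b - 1) (τ - ξ ^ 3) * jbw (-b) (τ - ξ ^ 3)) *
              f (ξ, τ) := by ring
          _ = _ := by
            rw [jbw_mul, jbw_mul, neg_add_cancel, jbw_zero, one_mul,
              show b - 1 + -b = -1 by ring]
      · simp [hq]
    have e2 (ξ : ℝ) :
        S.indicator (fun q => jbw (-s) q.1 * jbw (b - 1) (q.2 - q.1 ^ 3)) (ξ, τ) ^ 2 =
        S.indicator (fun q => jbw (-2 * s) q.1 * jbw (-(2 - 2 * b)) (q.2 - q.1 ^ 3)) (ξ, τ) := by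
      by_cases hq : (ξ, τ) ∈ S
      · simp only [Set.indicator_of_mem hq]
        rw [mul_pow, jbw_pow_two, jbw_pow_two, show 2 * (b - 1) = -(2 - 2 * b) by ring,
          show 2 * -s = -2 * s by ring]
      · simp [hq]
    have e3 (ξ : ℝ) : (jbw s ξ * jbw (-b) (τ - ξ ^ 3) * f (ξ, τ)) ^ 2 =
        jbw (2 * s) ξ * jbw (-2 * b) (τ - ξ ^ 3) * f (ξ, τ) ^ 2 := by
      rw [mul_pow, mul_pow, jbw_pow_two, jbw_pow_two, show 2 * -b = -2 * b by ring]
    simp_rw [e1, e2, e3] at h3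
    rw [← lineIntegral] at h3
    calc _ ≤ jbw (2 * σ) τ * ((C₀ * jbw (-2 * σ) τ) *
          ∫⁻ ξ, jbw (2 * s) ξ * jbw (-2 * b) (τ - ξ ^ 3) * f (ξ, τ) ^ 2) := by
          gcongr
          exact h3.trans (mul_le_mul_left (h τ) _)
      _ = (jbw (2 * σ) τ * jbw (-2 * σ) τ) *
          (C₀ * ∫⁻ ξ, jbw (2 * s) ξ * jbw (-2 * b) (τ - ξ ^ 3) * f (ξ, τ) ^ 2) := by ring
      _ = _ := by rw [jbw_mul, show 2 * σ + -2 * σ = 0 by ring, jbw_zero, one_mul]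
  simp_rw [setLIntegral_line _ _ hS hf]
  refine (hC _ (measurable_lineIntegral hS hf)).trans ?_
  rw [ENNReal.coe_mul, mul_assoc, energy, Measure.volume_eq_prod,
    lintegral_prod_symm' _ (by fun_prop),
    ← lintegral_const_mul' (C₀ : ℝ≥0∞) _ ENNReal.coe_ne_top]
  exact mul_le_mul_right (lintegral_mono h2) _

/-- Cauchy–Schwarz in (ξ, τ) together: the kernel factor, integrated first in τ and then in ξ, gives
⟨υ⟩^{-2/3}. After exchanging integrals, the υ-integral puts ⟨ξ³⟩^{2σ-2/3} on f, and this is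
comparable to ⟨ξ⟩^{2s} because 3(2σ-2/3) = 2s. Hence no restriction on s. The shift by 2/3 in the
weight is why A is asked to exceed |2σ| by 3 instead of 2. -/
lemma exists_lintegral_sq_curve {A s b : ℝ} (hb : b < 1 / 2)
    (hA : |2 * ((s + 1) / 3)| + 3 ≤ A) :
    ∃ C : ℝ≥0, ∀ f : ℝ × ℝ → ℝ≥0∞, Measurable f →
      ∫⁻ υ, jbw (2 * ((s + 1) / 3)) υ * (∫⁻ q,
        jbw (-A) (υ - q.1 ^ 3) * jbw (-1) (q.2 - q.1 ^ 3) * f q) ^ 2 ≤ C * energy s b f := by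
  set σ := (s + 1) / 3 with hσ
  obtain ⟨C₁, hC₁⟩ := exists_lintegral_jbw (β := 2 - 2 * b) (by linarith)
  obtain ⟨C₂, hC₂⟩ := exists_lintegral_sub_cube (β := A) (by linarith [abs_nonneg (2 * σ)])
  obtain ⟨C₃, hC₃⟩ := exists_lintegral_conv_jbw (A := A) (p := 2 * σ - 2 / 3) (by
    have := abs_sub (2 * σ) (2 / 3)
    rw [abs_of_pos (show (0 : ℝ) < 2 / 3 by norm_num)] at this
    linarith)
  set M := Real.toNNReal (2 ^ |2 * σ - 2 / 3|)
  have hM (ξ : ℝ) : jbw (2 * σ - 2 / 3) (ξ ^ 3) ≤ M * jbw (2 * s) ξ := by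
    rw [← ENNReal.ofReal, jbw, jbw, ← ENNReal.ofReal_mul (by positivity)]
    refine ENNReal.ofReal_le_ofReal ?_
    have := jb_cube_rpow_le (2 * σ - 2 / 3) ξ
    rwa [show 3 * (2 * σ - 2 / 3) = 2 * s by rw [hσ]; ring] at this
  refine ⟨C₁ * C₂ * (C₃ * M), fun f hf => ?_⟩
  have h1 (υ : ℝ) : jbw (2 * σ) υ * (∫⁻ q : ℝ × ℝ,
        jbw (-A) (υ - q.1 ^ 3) * jbw (-1) (q.2 - q.1 ^ 3) * f q) ^ 2 ≤
      C₁ * C₂ * ∫⁻ q : ℝ × ℝ, (jbw (-A) (υ - q.1 ^ 3) * jbw (2 * σ - 2 / 3) υ) *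
        (jbw (-2 * b) (q.2 - q.1 ^ 3) * f q ^ 2) := by
    have h2 := lintegral_mul_sq_le (μ := (volume : Measure (ℝ × ℝ)))
      (u := fun q => jbw (-A / 2) (υ - q.1 ^ 3) * jbw (b - 1) (q.2 - q.1 ^ 3))
      (v := fun q => jbw (-A / 2) (υ - q.1 ^ 3) * (jbw (-b) (q.2 - q.1 ^ 3) * f q))
      (by fun_prop) (by fun_prop)
    have e1 (q : ℝ × ℝ) : jbw (-A / 2) (υ - q.1 ^ 3) * jbw (b - 1) (q.2 - q.1 ^ 3) *
        (jbw (-A / 2) (υ - q.1 ^ 3) * (jbw (-b) (q.2 - q.1 ^ 3) * f q)) =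
        jbw (-A) (υ - q.1 ^ 3) * jbw (-1) (q.2 - q.1 ^ 3) * f q := by
      calc _ = (jbw (-A / 2) (υ - q.1 ^ 3) * jbw (-A / 2) (υ - q.1 ^ 3)) *
            (jbw (b - 1) (q.2 - q.1 ^ 3) * jbw (-b) (q.2 - q.1 ^ 3)) * f q := by ring
        _ = _ := by
          rw [jbw_mul, jbw_mul, show b - 1 + -b = -1 by ring, add_halves]
    have e2 (q : ℝ × ℝ) : (jbw (-A / 2) (υ - q.1 ^ 3) * jbw (b - 1) (q.2 - q.1 ^ 3)) ^ 2 =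
        jbw (-A) (υ - q.1 ^ 3) * jbw (-(2 - 2 * b)) (q.2 - q.1 ^ 3) := by
      rw [mul_pow, jbw_pow_two, jbw_pow_two, mul_div_cancel₀ _ two_ne_zero,
        show 2 * (b - 1) = -(2 - 2 * b) by ring]
    have e3 (q : ℝ × ℝ) :
        (jbw (-A / 2) (υ - q.1 ^ 3) * (jbw (-b) (q.2 - q.1 ^ 3) * f q)) ^ 2 =
        jbw (-A) (υ - q.1 ^ 3) * (jbw (-2 * b) (q.2 - q.1 ^ 3) * f q ^ 2) := by
      rw [mul_pow, mul_pow, jbw_pow_two, jbw_pow_two, mul_div_cancel₀ _ two_ne_zero,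
        show 2 * -b = -2 * b by ring]
    simp_rw [e1, e2, e3] at h2
    have h3 : ∫⁻ q : ℝ × ℝ, jbw (-A) (υ - q.1 ^ 3) * jbw (-(2 - 2 * b)) (q.2 - q.1 ^ 3) ≤
        C₁ * (C₂ * jbw (-2 / 3) υ) := by
      rw [Measure.volume_eq_prod, lintegral_prod _ (by fun_prop)]
      have (ξ : ℝ) : ∫⁻ τ, jbw (-A) (υ - ξ ^ 3) * jbw (-(2 - 2 * b)) (τ - ξ ^ 3) =
          C₁ * jbw (-A) (υ - ξ ^ 3) := by
        rw [lintegral_const_mul' _ _ (jbw_ne_top _ _),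
          lintegral_sub_right_eq_self (fun x => jbw (-(2 - 2 * b)) x), hC₁, mul_comm]
      simp_rw [this]
      rw [lintegral_const_mul' _ _ ENNReal.coe_ne_top]
      exact mul_le_mul_right (hC₂ υ) _
    have e4 (q : ℝ × ℝ) : (jbw (-A) (υ - q.1 ^ 3) * jbw (2 * σ - 2 / 3) υ) *
        (jbw (-2 * b) (q.2 - q.1 ^ 3) * f q ^ 2) = jbw (2 * σ - 2 / 3) υ *
          (jbw (-A) (υ - q.1 ^ 3) * (jbw (-2 * b) (q.2 - q.1 ^ 3) * f q ^ 2)) := by ring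
    simp_rw [e4]
    rw [lintegral_const_mul' _ _ (jbw_ne_top _ _)]
    calc _ ≤ jbw (2 * σ) υ * (C₁ * (C₂ * jbw (-2 / 3) υ) *
          ∫⁻ q : ℝ × ℝ, jbw (-A) (υ - q.1 ^ 3) * (jbw (-2 * b) (q.2 - q.1 ^ 3) * f q ^ 2)) := by
          gcongr
          exact h2.trans (mul_le_mul_left h3 _)
      _ = C₁ * C₂ * ((jbw (2 * σ) υ * jbw (-2 / 3) υ) *
          ∫⁻ q : ℝ × ℝ, jbw (-A) (υ - q.1 ^ 3) *
            (jbw (-2 * b) (q.2 - q.1 ^ 3) * f q ^ 2)) := by ring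
      _ = _ := by rw [jbw_mul, show 2 * σ + -2 / 3 = 2 * σ - 2 / 3 by ring]
  calc _ ≤ ∫⁻ υ, C₁ * C₂ * ∫⁻ q : ℝ × ℝ, (jbw (-A) (υ - q.1 ^ 3) * jbw (2 * σ - 2 / 3) υ) *
        (jbw (-2 * b) (q.2 - q.1 ^ 3) * f q ^ 2) := lintegral_mono h1
    _ = C₁ * C₂ * ∫⁻ q : ℝ × ℝ, ∫⁻ υ, (jbw (-A) (υ - q.1 ^ 3) * jbw (2 * σ - 2 / 3) υ) *
        (jbw (-2 * b) (q.2 - q.1 ^ 3) * f q ^ 2) := by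
      rw [lintegral_const_mul' _ _ (ENNReal.mul_ne_top ENNReal.coe_ne_top ENNReal.coe_ne_top),
        lintegral_lintegral_swap]
      fun_prop
    _ ≤ C₁ * C₂ * ∫⁻ q : ℝ × ℝ, C₃ * M *
        (jbw (2 * s) q.1 * jbw (-2 * b) (q.2 - q.1 ^ 3) * f q ^ 2) := by
      gcongr with q
      rw [lintegral_mul_const _ (by fun_prop)]
      have h5 := hC₃ (q.1 ^ 3)
      simp_rw [jbw_sub_comm _ (q.1 ^ 3)] at h5
      calc _ ≤ (C₃ * (M * jbw (2 * s) q.1)) * (jbw (-2 * b) (q.2 - q.1 ^ 3) * f q ^ 2) := by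
            gcongr
            exact h5.trans (mul_le_mul_right (hM q.1) _)
        _ = _ := by ring
    _ = _ := by
      rw [lintegral_const_mul' _ _ (ENNReal.mul_ne_top ENNReal.coe_ne_top ENNReal.coe_ne_top),
        energy]
      push_cast; ring

/-! ### The region of the correction term -/

lemma measurableSet_regionR (K : ℝ) : MeasurableSet (regionR K) :=
  MeasurableSet.inter (s₁ := {q : ℝ × ℝ | 1 ≤ |q.2|}) (s₂ := {q : ℝ × ℝ | K * |q.1| ^ 3 ≤ |q.2|})
    (measurableSet_le (by fun_prop) (by fun_prop)) (measurableSet_le (by fun_prop) (by fun_prop))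

/-- On the region |ξ|³ ≤ |τ|/K, hence |τ-ξ³| ≥ (1-1/K)|τ|; and |τ| ≥ 1 gives ⟨τ⟩ ≤ 2|τ|. -/
lemma jb_le_of_mem_regionR {K : ℝ} (hK : 1 < K) {q : ℝ × ℝ} (hq : q ∈ regionR K) :
    jb q.2 ≤ 2 * (K / (K - 1)) * jb (q.2 - q.1 ^ 3) := by
  have hK' : 0 < K - 1 := sub_pos.2 hK
  have h1 := jb_le_one_add_abs q.2
  have h2 : |q.2| - |q.1| ^ 3 ≤ |q.2 - q.1 ^ 3| := by
    rw [← abs_pow]; exact abs_sub_abs_le_abs_sub _ _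
  have h3 := abs_le_jb (q.2 - q.1 ^ 3)
  obtain ⟨h4, h5⟩ := hq
  rw [mul_div_assoc', div_mul_eq_mul_div, le_div_iff₀ hK']
  have h6 : (K - 1) * |q.2| ≤ K * |q.2 - q.1 ^ 3| := by nlinarith
  nlinarith

/-- No Cauchy–Schwarz in ξ here: since σ ≥ 0, the weight ⟨τ⟩^σ passes under the ξ-integral and
becomes ⟨τ-ξ³⟩^σ, and σ-1 = (s-2)/3. -/
lemma exists_lintegral_sq_regionR {A s K : ℝ} (hK : 1 < K) (hs : -1 ≤ s)
    (hA : |2 * ((s + 1) / 3)| + 2 ≤ A) :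
    ∃ C : ℝ≥0, ∀ f : ℝ × ℝ → ℝ≥0∞, Measurable f →
      ∫⁻ υ, jbw (2 * ((s + 1) / 3)) υ * (∫⁻ q in regionR K,
        jbw (-A) (υ - q.2) * jbw (-1) (q.2 - q.1 ^ 3) * f q) ^ 2 ≤
      C * ∫⁻ τ, (∫⁻ ξ, (regionR K).indicator
        (fun q => jbw ((s - 2) / 3) (q.2 - q.1 ^ 3) * f q) (ξ, τ)) ^ 2 := by
  obtain ⟨C, hC⟩ := exists_lintegral_sq_conv hA
  set σ := (s + 1) / 3 with hσ
  have hσ0 : 0 ≤ σ := div_nonneg (by linarith) (by norm_num)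
  have hK' : 0 < K - 1 := sub_pos.2 hK
  set M := Real.toNNReal ((2 * (K / (K - 1))) ^ σ)
  refine ⟨C * M ^ 2, fun f hf => ?_⟩
  have hR := measurableSet_regionR K
  simp_rw [setLIntegral_line _ _ hR hf]
  refine (hC _ (measurable_lineIntegral hR hf)).trans ?_
  rw [ENNReal.coe_mul, mul_assoc, ← lintegral_const_mul' ((M ^ 2 : ℝ≥0) : ℝ≥0∞) _
    ENNReal.coe_ne_top]
  refine mul_le_mul_right (lintegral_mono fun τ => ?_) _
  rw [← jbw_pow_two, ← mul_pow, ENNReal.coe_pow, ← mul_pow]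
  refine pow_le_pow_left' ?_ 2
  rw [lineIntegral, ← lintegral_const_mul' _ _ (jbw_ne_top _ _),
    ← lintegral_const_mul' _ _ ENNReal.coe_ne_top]
  refine lintegral_mono fun ξ => ?_
  by_cases hq : (ξ, τ) ∈ regionR K
  · simp only [Set.indicator_of_mem hq]
    rw [← mul_assoc, ← mul_assoc]
    refine mul_le_mul_left ?_ _
    have h1 : jbw σ τ ≤ M * jbw σ (τ - ξ ^ 3) := by
      rw [← ENNReal.ofReal, jbw, jbw, ← ENNReal.ofReal_mul (by positivity),
        ← Real.mul_rpow (by positivity) (jb_nonneg _)]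
      exact ENNReal.ofReal_le_ofReal
        (Real.rpow_le_rpow (jb_nonneg _) (jb_le_of_mem_regionR hK hq) hσ0)
    refine (mul_le_mul_left h1 _).trans ?_
    rw [mul_assoc, jbw_mul, show σ + -1 = (s - 2) / 3 by rw [hσ]; ring]
  · simp [hq]

/-- The majorant of the Duhamel kernel. -/
def kernelBound (A υ : ℝ) (q : ℝ × ℝ) : ℝ≥0∞ :=
  (jbw (-A) (υ - q.2) + jbw (-A) (υ - q.1 ^ 3)) * jbw (-1) (q.2 - q.1 ^ 3)

/-- The weighted `L²` bound for the Duhamel term, without correction term. -/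
theorem exists_lintegral_sq_kernelBound {A s b : ℝ} (hb : b < 1 / 2) (hs : -1 ≤ s)
    (hs' : s ≤ 2 - 3 * b) (hA : |2 * ((s + 1) / 3)| + 3 ≤ A) :
    ∃ C : ℝ≥0, ∀ f : ℝ × ℝ → ℝ≥0∞, Measurable f →
      ∫⁻ υ, jbw (2 * ((s + 1) / 3)) υ * (∫⁻ q, kernelBound A υ q * f q) ^ 2 ≤
        C * energy s b f := by
  obtain ⟨C₀, hC₀⟩ := exists_lintegral_weight_sub_cube (s := s) (β := 2 - 2 * b)
    (by linarith) hs (by linarith)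
  obtain ⟨C₁, hC₁⟩ := exists_lintegral_sq_line (A := A) (s := s) (b := b) Set.univ
    MeasurableSet.univ (by linarith) (C₀ := C₀) (by simpa using hC₀)
  obtain ⟨C₂, hC₂⟩ := exists_lintegral_sq_curve hb hA
  refine ⟨2 * (C₁ + C₂), fun f hf => ?_⟩
  set σ := (s + 1) / 3
  have h1 := hC₁ f hf
  have h2 := hC₂ f hf
  rw [Measure.restrict_univ] at h1
  have h3 (υ : ℝ) : jbw (2 * σ) υ * (∫⁻ q, kernelBound A υ q * f q) ^ 2 ≤
      2 * (jbw (2 * σ) υ * (∫⁻ q : ℝ × ℝ,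
        jbw (-A) (υ - q.2) * jbw (-1) (q.2 - q.1 ^ 3) * f q) ^ 2 +
      jbw (2 * σ) υ * (∫⁻ q : ℝ × ℝ,
        jbw (-A) (υ - q.1 ^ 3) * jbw (-1) (q.2 - q.1 ^ 3) * f q) ^ 2) := by
    simp_rw [kernelBound, add_mul]
    rw [lintegral_add_left (by fun_prop), ← mul_add, mul_left_comm]
    exact mul_le_mul_right (ennreal_add_sq_le _ _) _
  refine (lintegral_mono h3).trans ?_
  rw [lintegral_const_mul' _ _ ENNReal.ofNat_ne_top, lintegral_add_left]
  · calc _ ≤ 2 * (C₁ * energy s b f + C₂ * energy s b f) := by gcongr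
      _ = _ := by push_cast; ring
  · refine Measurable.mul (by fun_prop) (Measurable.pow_const ?_ _)
    exact Measurable.lintegral_prod_right' (f := fun p : ℝ × (ℝ × ℝ) =>
      jbw (-A) (p.1 - p.2.2) * jbw (-1) (p.2.2 - p.2.1 ^ 3) * f p.2) (by fun_prop)

/-- The weighted `L²` bound for the Duhamel term, with correction term. -/
theorem exists_lintegral_sq_kernelBound_add {A s b K : ℝ} (hb : b < 1 / 2) (hs : 0 ≤ s)
    (hK : 1 < K) (hA : |2 * ((s + 1) / 3)| + 3 ≤ A) :
    ∃ C : ℝ≥0, ∀ f : ℝ × ℝ → ℝ≥0∞, Measurable f →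
      ∫⁻ υ, jbw (2 * ((s + 1) / 3)) υ * (∫⁻ q, kernelBound A υ q * f q) ^ 2 ≤
        C * (energy s b f + ∫⁻ τ, (∫⁻ ξ, (regionR K).indicator
          (fun q => jbw ((s - 2) / 3) (q.2 - q.1 ^ 3) * f q) (ξ, τ)) ^ 2) := by
  have hR := measurableSet_regionR K
  obtain ⟨C₀, hC₀⟩ := exists_lintegral_weight_compl_regionR (s := s) (β := 2 - 2 * b)
    (by linarith) hs hK
  obtain ⟨C₁, hC₁⟩ := exists_lintegral_sq_line (A := A) (s := s) (b := b) (regionR K)ᶜ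
    hR.compl (by linarith) hC₀
  obtain ⟨C₂, hC₂⟩ := exists_lintegral_sq_curve hb hA
  obtain ⟨C₃, hC₃⟩ := exists_lintegral_sq_regionR (A := A) (s := s) hK (by linarith) (by linarith)
  refine ⟨4 * (C₁ + C₂ + C₃), fun f hf => ?_⟩
  set σ := (s + 1) / 3
  have h1 := hC₁ f hf
  have h2 := hC₂ f hf
  have h4 := hC₃ f hf
  set E := energy s b f
  set T := ∫⁻ τ, (∫⁻ ξ, (regionR K).indicator
          (fun q => jbw ((s - 2) / 3) (q.2 - q.1 ^ 3) * f q) (ξ, τ)) ^ 2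
  have h3 (υ : ℝ) : jbw (2 * σ) υ * (∫⁻ q, kernelBound A υ q * f q) ^ 2 ≤
      4 * (jbw (2 * σ) υ * (∫⁻ q in regionR K,
        jbw (-A) (υ - q.2) * jbw (-1) (q.2 - q.1 ^ 3) * f q) ^ 2 +
      (jbw (2 * σ) υ * (∫⁻ q in (regionR K)ᶜ,
        jbw (-A) (υ - q.2) * jbw (-1) (q.2 - q.1 ^ 3) * f q) ^ 2 +
      jbw (2 * σ) υ * (∫⁻ q : ℝ × ℝ,
        jbw (-A) (υ - q.1 ^ 3) * jbw (-1) (q.2 - q.1 ^ 3) * f q) ^ 2)) := by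
    simp_rw [kernelBound, add_mul]
    rw [lintegral_add_left (by fun_prop), ← mul_add, ← mul_add, mul_left_comm,
      ← lintegral_add_compl _ hR]
    refine mul_le_mul_right ?_ _
    rw [add_assoc]
    refine (ennreal_add_sq_le _ _).trans ?_
    -- The square of a sum is split twice, at a cost of 2 each time; the region term is split off
    -- first and needs only one of the two factors.
    rw [show (4 : ℝ≥0∞) = 2 * 2 by norm_num, mul_assoc]
    refine mul_le_mul_right ?_ _
    rw [mul_add]
    refine add_le_add ?_ (ennreal_add_sq_le _ _)
    rw [two_mul]
    exact le_self_add
  have hm (S : Set (ℝ × ℝ)) : Measurable fun υ => jbw (2 * σ) υ * (∫⁻ q in S,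
      jbw (-A) (υ - q.2) * jbw (-1) (q.2 - q.1 ^ 3) * f q) ^ 2 := by
    refine Measurable.mul (by fun_prop) (Measurable.pow_const ?_ _)
    exact Measurable.lintegral_prod_right' (f := fun p : ℝ × (ℝ × ℝ) =>
      jbw (-A) (p.1 - p.2.2) * jbw (-1) (p.2.2 - p.2.1 ^ 3) * f p.2) (by fun_prop)
  refine (lintegral_mono h3).trans ?_
  rw [lintegral_const_mul' _ _ ENNReal.ofNat_ne_top, lintegral_add_left (hm _),
    lintegral_add_left (hm _)]
  calc _ ≤ 4 * (C₃ * T + (C₁ * E + C₂ * E)) := by gcongr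
    _ ≤ 4 * (C₃ * (E + T) + (C₁ * (E + T) + C₂ * (E + T))) := by
      gcongr
      exacts [le_add_self, le_self_add, le_self_add]
    _ = _ := by push_cast; ring

/-! ### The symbol of the Duhamel operator -/

open FourierTransform in
lemma fourier1_eq (f : ℝ → ℂ) (ξ : ℝ) : fourier1 f ξ = 𝓕 f (ξ / (2 * Real.pi)) := by
  rw [Real.fourier_real_eq_integral_exp_smul, fourier1]
  refine integral_congr_ae (Eventually.of_forall fun x => ?_)
  simp only [smul_eq_mul]
  congr 2
  have : (Real.pi : ℂ) ≠ 0 := by exact_mod_cast Real.pi_ne_zero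
  push_cast
  field_simp

lemma exists_mul_schwartz (h : 𝓢(ℝ, ℂ)) : ∃ g : 𝓢(ℝ, ℂ), ∀ t, g t = t * h t := by
  have hg : (fun t : ℝ => (t : ℂ)).HasTemperateGrowth :=
    Complex.ofRealCLM.hasTemperateGrowth
  exact ⟨SchwartzMap.smulLeftCLM ℂ (fun t : ℝ => (t : ℂ)) h, fun t => by
    rw [SchwartzMap.smulLeftCLM_apply_apply hg, smul_eq_mul]⟩

lemma jb_rpow_neg_ge (A : ℝ) (x : ℝ) :
    1 ≤ (2 ^ (⌈|A|⌉₊) * (1 + |x| ^ (⌈|A|⌉₊))) * jb x ^ (-A) := by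
  set k := ⌈|A|⌉₊
  have h1 : jb x ^ A ≤ jb x ^ k := by
    rw [← Real.rpow_natCast]
    exact Real.rpow_le_rpow_of_exponent_le (one_le_jb x) ((le_abs_self A).trans (Nat.le_ceil _))
  have h2 : jb x ^ k ≤ 2 ^ k * (1 + |x| ^ k) := by
    have h3 : jb x ≤ 2 * max 1 |x| := by
      linarith [jb_le_one_add_abs x, le_max_left 1 |x|, le_max_right 1 |x|]
    calc jb x ^ k ≤ (2 * max 1 |x|) ^ k := pow_le_pow_left₀ (jb_nonneg x) h3 k
      _ = 2 ^ k * max 1 |x| ^ k := mul_pow _ _ _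
      _ ≤ _ := by
        gcongr
        rcases max_cases 1 |x| with ⟨h, _⟩ | ⟨h, _⟩ <;> rw [h]
        · simp
        · simp
  have hp : 0 < jb x ^ A := Real.rpow_pos_of_pos (jb_pos x) A
  rw [Real.rpow_neg (jb_nonneg x), ← div_eq_mul_inv, le_div_iff₀ hp, one_mul]
  exact h1.trans h2

open FourierTransform in
/-- The Fourier transform of a Schwartz function is rapidly decreasing. -/
lemma exists_norm_fourier1_le (h : 𝓢(ℝ, ℂ)) (A : ℝ) : ∃ C : ℝ, 0 ≤ C ∧
    ∀ ξ, ‖fourier1 h ξ‖ ≤ C * jb ξ ^ (-A) := by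
  set k := ⌈|A|⌉₊
  obtain ⟨C₀, hC₀⟩ := (𝓕 h).decay 0 0
  obtain ⟨C₁, hC₁⟩ := (𝓕 h).decay k 0
  simp only [pow_zero, one_mul, norm_iteratedFDeriv_zero] at hC₀ hC₁
  set D := C₀ + (2 * Real.pi) ^ k * C₁
  have hb (ξ : ℝ) : ‖fourier1 h ξ‖ * (1 + |ξ| ^ k) ≤ D := by
    have h0 := hC₀.2 (ξ / (2 * Real.pi))
    have h1 := hC₁.2 (ξ / (2 * Real.pi))
    have e : fourier1 h ξ = 𝓕 h (ξ / (2 * Real.pi)) := fourier1_eq _ _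
    rw [← e] at h0 h1
    rw [Real.norm_eq_abs, abs_div, abs_of_pos Real.two_pi_pos, div_pow] at h1
    have h2 : |ξ| ^ k * ‖fourier1 h ξ‖ ≤ (2 * Real.pi) ^ k * C₁ := by
      calc _ = (2 * Real.pi) ^ k * (|ξ| ^ k / (2 * Real.pi) ^ k * ‖fourier1 h ξ‖) := by
            field_simp
        _ ≤ _ := by gcongr
    linarith
  have hD : 0 ≤ D := le_trans (by positivity) (hb 0)
  refine ⟨D * 2 ^ k, by positivity, fun ξ => ?_⟩
  have hp : 0 ≤ jb ξ ^ (-A) := Real.rpow_nonneg (jb_nonneg ξ) _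
  calc ‖fourier1 h ξ‖ = ‖fourier1 h ξ‖ * 1 := (mul_one _).symm
    _ ≤ ‖fourier1 h ξ‖ * ((2 ^ k * (1 + |ξ| ^ k)) * jb ξ ^ (-A)) := by
      gcongr; exact jb_rpow_neg_ge A ξ
    _ = (‖fourier1 h ξ‖ * (1 + |ξ| ^ k)) * (2 ^ k * jb ξ ^ (-A)) := by ring
    _ ≤ D * (2 ^ k * jb ξ ^ (-A)) := by gcongr; exact hb ξ
    _ = _ := by ring

open FourierTransform in
lemma hasDerivAt_fourier1 (h : 𝓢(ℝ, ℂ)) (ξ : ℝ) :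
    HasDerivAt (fourier1 h) (-Complex.I * fourier1 (fun t => t * h t) ξ) ξ := by
  obtain ⟨g, hg⟩ := exists_mul_schwartz h
  have hint : Integrable (fun x : ℝ => x • h x) := by
    refine g.integrable.congr (Eventually.of_forall fun t => ?_)
    simp [hg]
  have h1 := (Real.hasDerivAt_fourier h.integrable hint (ξ / (2 * Real.pi))).scomp ξ
    ((hasDerivAt_id ξ).div_const (2 * Real.pi))
  have e : fourier1 h = (𝓕 (h : ℝ → ℂ)) ∘ fun x => id x / (2 * Real.pi) :=
    funext fun x => fourier1_eq _ _
  rw [e]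
  refine h1.congr_deriv ?_
  rw [fourier1_eq]
  simp only [Real.fourier_real_eq_integral_exp_smul]
  rw [← integral_const_mul, ← integral_smul]
  refine integral_congr_ae (Eventually.of_forall fun x => ?_)
  have : (Real.pi : ℂ) ≠ 0 := by exact_mod_cast Real.pi_ne_zero
  simp only [smul_eq_mul, Complex.real_smul]
  push_cast
  field_simp

lemma continuous_fourier1 (h : 𝓢(ℝ, ℂ)) : Continuous (fourier1 h) :=
  continuous_iff_continuousAt.2 fun ξ => (hasDerivAt_fourier1 h ξ).continuousAt

/-- The time Fourier transform of `h(t) ∫₀ᵗ e^{i(t-t')ξ³} e^{it'τ} dt'` at `υ`, where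
`q = (ξ, τ)`. -/
def duhamelSymbol (h : ℝ → ℂ) (υ : ℝ) (q : ℝ × ℝ) : ℂ :=
  if q.2 - q.1 ^ 3 = 0 then fourier1 (fun t => t * h t) (υ - q.1 ^ 3)
  else (fourier1 h (υ - q.2) - fourier1 h (υ - q.1 ^ 3)) / (Complex.I * ((q.2 - q.1 ^ 3 : ℝ) : ℂ))

lemma measurable_duhamelSymbol (h : 𝓢(ℝ, ℂ)) :
    Measurable fun p : ℝ × (ℝ × ℝ) => duhamelSymbol h p.1 p.2 := by
  obtain ⟨g, hg⟩ := exists_mul_schwartz h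
  have hg' : (fun t : ℝ => (t : ℂ) * h t) = g := funext fun t => (hg t).symm
  have h1 := (continuous_fourier1 h).measurable
  have h2 := (continuous_fourier1 g).measurable
  unfold duhamelSymbol
  rw [hg']
  refine Measurable.ite (measurableSet_eq_fun (by fun_prop) (by fun_prop)) (by fun_prop) ?_
  refine Measurable.div (by fun_prop) (by fun_prop)

/-- The Duhamel symbol is bounded by the kernel majorant. -/
lemma exists_norm_duhamelSymbol_le (h : 𝓢(ℝ, ℂ)) {A : ℝ} (hA : 0 ≤ A) : ∃ C : ℝ, 0 ≤ C ∧
    ∀ υ q, ‖duhamelSymbol h υ q‖ ≤ C * ((jb (υ - q.2) ^ (-A) + jb (υ - q.1 ^ 3) ^ (-A)) *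
      jb (q.2 - q.1 ^ 3) ^ (-1 : ℝ)) := by
  obtain ⟨g, hg⟩ := exists_mul_schwartz h
  have hg' : (fun t : ℝ => (t : ℂ) * h t) = g := funext fun t => (hg t).symm
  obtain ⟨C₀, hC₀, h0⟩ := exists_norm_fourier1_le h A
  obtain ⟨C₁, hC₁, h1⟩ := exists_norm_fourier1_le g A
  refine ⟨2 * C₀ + 2 * (C₁ * 2 ^ A), by positivity, fun υ q => ?_⟩
  set a := υ - q.1 ^ 3
  set b := υ - q.2
  set lam := q.2 - q.1 ^ 3
  have hab : a - b = lam := by simp only [a, b, lam]; ring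
  have ha : 0 < jb a ^ (-A) := Real.rpow_pos_of_pos (jb_pos _) _
  have hb : 0 < jb b ^ (-A) := Real.rpow_pos_of_pos (jb_pos _) _
  have hl := jb_pos lam
  rw [Real.rpow_neg_one, ← div_eq_mul_inv, mul_div_assoc', le_div_iff₀ hl]
  -- For |λ| ≤ 1 the symbol is a difference quotient of ĥ, or its limit, and the derivative, the
  -- transform of t·h(t) up to -i, decays like ⟨a⟩^{-A} within distance 1 of a. For |λ| > 1 the
  -- triangle inequality suffices, as |λ| and ⟨λ⟩ are comparable.
  rcases le_or_gt |lam| 1 with hlam | hlam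
  · have hj : jb lam ≤ 2 := (jb_le_one_add_abs _).trans (by linarith)
    have hgx (x : ℝ) (hx : |x - a| ≤ 1) : ‖fourier1 g x‖ ≤ C₁ * 2 ^ A * jb a ^ (-A) := by
      have h2 : jb a ≤ 2 * jb x := by
        have := jb_add_le x (a - x)
        rw [add_sub_cancel, abs_sub_comm] at this
        linarith [one_le_jb x]
      have h3 := Real.rpow_le_rpow_of_nonpos (jb_pos a) h2 (neg_nonpos.2 hA)
      rw [Real.mul_rpow two_pos.le (jb_nonneg _), Real.rpow_neg two_pos.le, inv_mul_eq_div,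
        div_le_iff₀ (by positivity)] at h3
      calc _ ≤ C₁ * jb x ^ (-A) := h1 x
        _ ≤ C₁ * (jb a ^ (-A) * 2 ^ A) := by gcongr
        _ = _ := by ring
    have key : ‖duhamelSymbol h υ q‖ ≤ C₁ * 2 ^ A * jb a ^ (-A) := by
      rw [duhamelSymbol]
      split_ifs with h4
      · rw [hg']; exact hgx a (by simp)
      · have h5 := Convex.norm_image_sub_le_of_norm_hasDerivWithin_le (s := Set.Icc (a - 1) (a + 1))
          (x := a) (y := b) (C := C₁ * 2 ^ A * jb a ^ (-A))
          (fun x _ => (hasDerivAt_fourier1 h x).hasDerivWithinAt) (fun x hx => by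
            rw [hg', norm_mul, norm_neg, Complex.norm_I, one_mul]
            exact hgx x (abs_le.2 ⟨by linarith [hx.1], by linarith [hx.2]⟩))
          (convex_Icc _ _) ⟨by linarith, by linarith⟩
          ⟨by linarith [(abs_le.1 hlam).2], by linarith [(abs_le.1 hlam).1]⟩
        rw [norm_div, norm_mul, Complex.norm_I, one_mul, Complex.norm_real, Real.norm_eq_abs,
          div_le_iff₀ (abs_pos.2 h4)]
        rwa [Real.norm_eq_abs, abs_sub_comm b a, hab] at h5
    calc _ ≤ (C₁ * 2 ^ A * jb a ^ (-A)) * 2 := by gcongr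
      _ = 2 * (C₁ * 2 ^ A) * jb a ^ (-A) := by ring
      _ ≤ (2 * C₀ + 2 * (C₁ * 2 ^ A)) * (jb b ^ (-A) + jb a ^ (-A)) := by
        gcongr <;> linarith
  · have h4 : lam ≠ 0 := by rintro h; rw [h, abs_zero] at hlam; linarith
    have hj : jb lam ≤ 2 * |lam| := (jb_le_one_add_abs _).trans (by linarith)
    have hpos := abs_pos.2 h4
    rw [duhamelSymbol, if_neg h4, norm_div, norm_mul, Complex.norm_I, one_mul, Complex.norm_real,
      Real.norm_eq_abs, div_mul_eq_mul_div, div_le_iff₀ hpos]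
    calc _ ≤ (C₀ * jb b ^ (-A) + C₀ * jb a ^ (-A)) * (2 * |lam|) := by
          gcongr
          exact (norm_sub_le _ _).trans (add_le_add (h0 b) (h0 a))
      _ = (2 * C₀) * (jb b ^ (-A) + jb a ^ (-A)) * |lam| := by ring
      _ ≤ _ := by
        gcongr
        linarith [show 0 ≤ 2 * (C₁ * 2 ^ A) by positivity]

lemma exists_enorm_duhamelSymbol_le (h : 𝓢(ℝ, ℂ)) {A : ℝ} (hA : 0 ≤ A) : ∃ C : ℝ≥0,
    ∀ υ q, ‖duhamelSymbol h υ q‖ₑ ≤ C * kernelBound A υ q := by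
  obtain ⟨C, hC, h1⟩ := exists_norm_duhamelSymbol_le h hA
  refine ⟨C.toNNReal, fun υ q => ?_⟩
  rw [← ofReal_norm]
  refine (ENNReal.ofReal_le_ofReal (h1 υ q)).trans_eq ?_
  have := jb_pos (υ - q.2)
  have := jb_pos (υ - q.1 ^ 3)
  have := jb_pos (q.2 - q.1 ^ 3)
  rw [ENNReal.ofReal_mul hC, ENNReal.ofReal_mul (by positivity),
    ENNReal.ofReal_add (by positivity) (by positivity)]
  rfl

/-- The oscillating integral `∫₀ᵗ e^{i(t-t')ξ³} e^{it'τ} dt'`, where `q = (ξ, τ)`. -/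
def duhamelPhase (t : ℝ) (q : ℝ × ℝ) : ℂ :=
  ∫ t' in (0 : ℝ)..t, Complex.exp (Complex.I * ((t - t' : ℝ) : ℂ) * (q.1 : ℂ) ^ 3) *
    Complex.exp (Complex.I * t' * q.2)

lemma duhamelPhase_eq_mul (t : ℝ) (q : ℝ × ℝ) :
    duhamelPhase t q = Complex.exp (Complex.I * t * (q.1 : ℂ) ^ 3) *
      ∫ t' in (0 : ℝ)..t, Complex.exp ((Complex.I * ((q.2 - q.1 ^ 3 : ℝ) : ℂ)) * t') := by
  rw [duhamelPhase, ← intervalIntegral.integral_const_mul]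
  congr 1
  ext t'
  rw [← Complex.exp_add, ← Complex.exp_add]
  congr 1
  push_cast; ring

lemma duhamelPhase_of_eq (t : ℝ) {q : ℝ × ℝ} (hq : q.2 - q.1 ^ 3 = 0) :
    duhamelPhase t q = Complex.exp (Complex.I * t * (q.1 : ℂ) ^ 3) * t := by
  rw [duhamelPhase_eq_mul, hq]
  simp

lemma duhamelPhase_of_ne (t : ℝ) {q : ℝ × ℝ} (hq : q.2 - q.1 ^ 3 ≠ 0) :
    duhamelPhase t q =
      (Complex.exp (Complex.I * t * q.2) - Complex.exp (Complex.I * t * (q.1 : ℂ) ^ 3)) /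
        (Complex.I * ((q.2 - q.1 ^ 3 : ℝ) : ℂ)) := by
  have h0 : Complex.I * ((q.2 - q.1 ^ 3 : ℝ) : ℂ) ≠ 0 :=
    mul_ne_zero Complex.I_ne_zero (by exact_mod_cast hq)
  rw [duhamelPhase_eq_mul, integral_exp_mul_complex h0, mul_div_assoc', mul_sub,
    ← Complex.exp_add, ← Complex.exp_add]
  congr 3
  · push_cast; ring_nf
  · simp

lemma measurable_duhamelPhase : Measurable fun p : ℝ × (ℝ × ℝ) => duhamelPhase p.1 p.2 := by
  have h (p : ℝ × (ℝ × ℝ)) : duhamelPhase p.1 p.2 = if p.2.2 - p.2.1 ^ 3 = 0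
      then Complex.exp (Complex.I * p.1 * (p.2.1 : ℂ) ^ 3) * p.1
      else (Complex.exp (Complex.I * p.1 * p.2.2) - Complex.exp (Complex.I * p.1 * (p.2.1 : ℂ) ^ 3)) /
        (Complex.I * ((p.2.2 - p.2.1 ^ 3 : ℝ) : ℂ)) := by
    split_ifs with hq
    · exact duhamelPhase_of_eq _ hq
    · exact duhamelPhase_of_ne _ hq
  simp_rw [h]
  refine Measurable.ite (measurableSet_eq_fun (by fun_prop) (by fun_prop)) (by fun_prop) ?_
  refine Measurable.div (by fun_prop) (by fun_prop)

lemma norm_exp_I_mul_ofReal_mul (x y : ℝ) : ‖Complex.exp (Complex.I * x * y)‖ = 1 := by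
  rw [show Complex.I * x * y = ((x * y : ℝ) : ℂ) * Complex.I by push_cast; ring,
    Complex.norm_exp_ofReal_mul_I]

/-- This crude bound only serves to justify Fubini for Schwartz data; the growth in t is absorbed by
the cutoff. -/
lemma norm_duhamelPhase_le (t : ℝ) (q : ℝ × ℝ) : ‖duhamelPhase t q‖ ≤ |t| := by
  have h := intervalIntegral.norm_integral_le_of_norm_le_const (a := 0) (b := t) (C := 1)
    (f := fun t' => Complex.exp (Complex.I * ((t - t' : ℝ) : ℂ) * (q.1 : ℂ) ^ 3) *
      Complex.exp (Complex.I * t' * q.2)) (fun t' _ => by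
      rw [norm_mul, norm_exp_I_mul_ofReal_mul, ← Complex.ofReal_pow, norm_exp_I_mul_ofReal_mul,
        one_mul])
  simpa [duhamelPhase] using h

lemma integral_mul_duhamelPhase (h : 𝓢(ℝ, ℂ)) (υ : ℝ) (q : ℝ × ℝ) :
    ∫ t : ℝ, Complex.exp (-Complex.I * t * υ) * (h t * duhamelPhase t q) =
      duhamelSymbol h υ q := by
  have hexp (y t : ℝ) : Complex.exp (-Complex.I * t * (υ - y : ℝ)) =
      Complex.exp (-Complex.I * t * υ) * Complex.exp (Complex.I * t * y) := by
    rw [← Complex.exp_add]; congr 1; push_cast; ring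
  rw [duhamelSymbol]
  split_ifs with hq
  · rw [fourier1]
    refine integral_congr_ae (Eventually.of_forall fun t => ?_)
    simp only [duhamelPhase_of_eq t hq, hexp]
    push_cast; ring
  · have hi (y : ℝ) : Integrable fun t : ℝ => Complex.exp (-Complex.I * t * y) * h t := by
      refine h.integrable.bdd_mul (c := 1) (by fun_prop) (Eventually.of_forall fun t => ?_)
      have := norm_exp_I_mul_ofReal_mul t (-y)
      rw [show Complex.I * t * ((-y : ℝ) : ℂ) = -Complex.I * t * y by push_cast; ring] at this
      exact this.le
    rw [fourier1, fourier1, ← integral_sub (hi _) (hi _), ← integral_div]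
    refine integral_congr_ae (Eventually.of_forall fun t => ?_)
    simp only [duhamelPhase_of_ne t hq, hexp]
    push_cast; ring

/-! ### The space-time Fourier transform of Schwartz functions -/

/-- The scaled identification of frequency space with `ℂ`. -/
def freqEquiv : (ℝ × ℝ) ≃L[ℝ] ℂ :=
  (ContinuousLinearEquiv.smulLeft (Units.mk0 (2 * Real.pi)⁻¹
    (inv_ne_zero Real.two_pi_pos.ne'))).trans Complex.equivRealProdCLM.symm

lemma freqEquiv_apply (q : ℝ × ℝ) :
    freqEquiv q = ⟨(2 * Real.pi)⁻¹ * q.1, (2 * Real.pi)⁻¹ * q.2⟩ := rfl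

open FourierTransform in
-- The product ℝ × ℝ carries the sup norm, which comes from no inner product, so the plane is
-- identified with ℂ. The factor (2π)⁻¹ in `freqEquiv` converts between the two normalizations of
-- the transform.
lemma fourier2_eq (M : 𝓢(ℝ × ℝ, ℂ)) (q : ℝ × ℝ) :
    fourier2 M q = 𝓕 (SchwartzMap.compCLMOfContinuousLinearEquiv ℂ Complex.equivRealProdCLM M)
      (freqEquiv q) := by
  rw [SchwartzMap.fourier_coe, Real.fourier_eq', fourier2]
  have h := Complex.volume_preserving_equiv_real_prod.integral_comp
    Complex.measurableEquivRealProd.measurableEmbedding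
    (fun p : ℝ × ℝ => Complex.exp (-Complex.I * (p.1 * q.1 + p.2 * q.2)) * M p)
  rw [← h]
  refine integral_congr_ae (Eventually.of_forall fun z => ?_)
  simp only [smul_eq_mul, Complex.inner, freqEquiv_apply]
  have hpi : (Real.pi : ℂ) ≠ 0 := by exact_mod_cast Real.pi_ne_zero
  have e : (Complex.measurableEquivRealProd z) = (z.re, z.im) := rfl
  have e' : (SchwartzMap.compCLMOfContinuousLinearEquiv ℂ Complex.equivRealProdCLM M) z =
    M (z.re, z.im) := rfl
  rw [e, e']
  congr 2
  simp only [Complex.mul_re, Complex.conj_re, Complex.conj_im]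
  push_cast
  field_simp
  ring

open FourierTransform in
lemma exists_fourier2_schwartz (M : 𝓢(ℝ × ℝ, ℂ)) :
    ∃ G : 𝓢(ℝ × ℝ, ℂ), ∀ q, G q = fourier2 M q :=
  ⟨SchwartzMap.compCLMOfContinuousLinearEquiv ℂ freqEquiv
    (𝓕 (SchwartzMap.compCLMOfContinuousLinearEquiv ℂ Complex.equivRealProdCLM M)),
    fun q => (fourier2_eq M q).symm⟩

open FourierTransform in
lemma exists_schwartz_fourier2 (G : 𝓢(ℝ × ℝ, ℂ)) :
    ∃ M : 𝓢(ℝ × ℝ, ℂ), ∀ q, fourier2 M q = G q := by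
  set H : 𝓢(ℂ, ℂ) := SchwartzMap.compCLMOfContinuousLinearEquiv ℂ freqEquiv.symm G
  refine ⟨SchwartzMap.compCLMOfContinuousLinearEquiv ℂ Complex.equivRealProdCLM.symm (𝓕⁻ H),
    fun q => ?_⟩
  rw [fourier2_eq]
  have : SchwartzMap.compCLMOfContinuousLinearEquiv ℂ Complex.equivRealProdCLM
      (SchwartzMap.compCLMOfContinuousLinearEquiv ℂ Complex.equivRealProdCLM.symm (𝓕⁻ H)) =
      𝓕⁻ H := by
    ext z
    exact congrArg _ (Complex.equivRealProdCLM.symm_apply_apply z)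
  rw [this, FourierTransform.fourier_fourierInv_eq]
  simp [H]

/-- Decay of a Schwartz function on the plane, in terms of its seminorms. -/
lemma norm_schwartz_le (f : 𝓢(ℝ × ℝ, ℂ)) (p : ℝ × ℝ) :
    ‖f p‖ ≤ (2 ^ 4 * (Finset.Iic (4, 0)).sup (schwartzSeminormFamily ℂ (ℝ × ℝ) ℂ) f) *
      ((1 + p.1 ^ 2)⁻¹ * (1 + p.2 ^ 2)⁻¹) := by
  have h := SchwartzMap.one_add_le_sup_seminorm_apply (𝕜 := ℂ) (m := (4, 0)) (k := 4) (n := 0)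
    le_rfl le_rfl f p
  rw [norm_iteratedFDeriv_zero] at h
  rw [← mul_inv, ← div_eq_mul_inv, le_div_iff₀ (by positivity), mul_comm]
  refine le_trans ?_ h
  gcongr
  have h1 : |p.1| ≤ ‖p‖ := norm_fst_le p
  have h2 : |p.2| ≤ ‖p‖ := norm_snd_le p
  have key (x : ℝ) (hx : |x| ≤ ‖p‖) : 1 + x ^ 2 ≤ (1 + ‖p‖) ^ 2 := by
    rw [← sq_abs]; nlinarith [abs_nonneg x]
  calc (1 + p.1 ^ 2) * (1 + p.2 ^ 2) ≤ (1 + ‖p‖) ^ 2 * (1 + ‖p‖) ^ 2 := by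
        gcongr
        exacts [key _ h1, key _ h2]
    _ = _ := by ring

lemma exists_norm_schwartz_le (f : 𝓢(ℝ × ℝ, ℂ)) : ∃ C : ℝ, 0 ≤ C ∧
    ∀ p, ‖f p‖ ≤ C * ((1 + p.1 ^ 2)⁻¹ * (1 + p.2 ^ 2)⁻¹) :=
  ⟨_, by positivity, norm_schwartz_le f⟩

/-! ### Density of Schwartz functions -/

lemma contDiff_jb : ContDiff ℝ ∞ jb := by
  have : jb = fun x => Real.sqrt (1 + x ^ 2) := by ext x; rw [jb, sq_abs]
  rw [this]
  exact ContDiff.sqrt (by fun_prop) fun x => by positivity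

/-- The weight of the `X^{s,b}` norm. -/
def xWeight (s b : ℝ) (q : ℝ × ℝ) : ℝ := jb q.1 ^ s * jb (q.2 - q.1 ^ 3) ^ b

lemma xWeight_pos (s b : ℝ) (q : ℝ × ℝ) : 0 < xWeight s b q :=
  mul_pos (Real.rpow_pos_of_pos (jb_pos _) _) (Real.rpow_pos_of_pos (jb_pos _) _)

lemma contDiff_xWeight (s b : ℝ) : ContDiff ℝ ∞ (xWeight s b) := by
  refine ContDiff.mul ?_ ?_
  · exact (contDiff_jb.comp contDiff_fst).rpow_const_of_ne fun q => (jb_pos _).ne'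
  · exact (contDiff_jb.comp (by fun_prop : ContDiff ℝ ∞ fun q : ℝ × ℝ =>
      q.2 - q.1 ^ 3)).rpow_const_of_ne fun q => (jb_pos _).ne'

lemma xNorm_eq (s b : ℝ) (F : ℝ × ℝ → ℂ) :
    xNorm s b F = eLpNorm (fun q => (xWeight s b q : ℂ) * F q) 2 volume := by
  rw [xNorm]
  refine eLpNorm_congr_norm_ae (Eventually.of_forall fun q => ?_)
  rw [norm_mul, norm_mul, norm_norm, norm_mul, Complex.norm_real, xWeight, norm_mul]

/-- Schwartz functions are dense in `X^{s,b}`. -/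
theorem exists_xTendsto (s b : ℝ) {F : ℝ × ℝ → ℂ} (hF : AEStronglyMeasurable F volume)
    (hF' : xNorm s b F < ⊤) : ∃ M : ℕ → 𝓢(ℝ × ℝ, ℂ), XTendsto s b M F := by
  have hw := contDiff_xWeight s b
  have hmem : MemLp (fun q => (xWeight s b q : ℂ) * F q) 2 volume :=
    ⟨(Complex.continuous_ofReal.comp hw.continuous).aestronglyMeasurable.mul hF,
      by rwa [← xNorm_eq]⟩
  have key (n : ℕ) : ∃ M : 𝓢(ℝ × ℝ, ℂ),
      xNorm s b (fun q => F q - fourier2 M q) ≤ ENNReal.ofReal (1 / ((n : ℝ) + 1)) := by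
    -- The weighted F lies in L², so it is close to a smooth compactly supported g. The weight is
    -- smooth and positive, so g divided by it is again a test function, hence the transform of some
    -- Schwartz M.
    obtain ⟨g, hg1, hg2, hg3⟩ := hmem.exist_eLpNorm_sub_le (by norm_num) (by norm_num)
      (show (0 : ℝ) < 1 / ((n : ℝ) + 1) by positivity)
    have hinv : ContDiff ℝ ∞ fun q => (((xWeight s b q)⁻¹ : ℝ) : ℂ) :=
      Complex.ofRealCLM.contDiff.comp (hw.inv fun q => (xWeight_pos s b q).ne')
    set G : 𝓢(ℝ × ℝ, ℂ) := HasCompactSupport.toSchwartzMap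
      (f := fun q => (((xWeight s b q)⁻¹ : ℝ) : ℂ) * g q) hg1.mul_left (hinv.mul hg2)
    obtain ⟨M, hM⟩ := exists_schwartz_fourier2 G
    refine ⟨M, ?_⟩
    rw [xNorm_eq]
    refine le_trans (le_of_eq ?_) hg3
    congr 1
    ext q
    have h0 : (xWeight s b q : ℂ) ≠ 0 := by exact_mod_cast (xWeight_pos s b q).ne'
    simp only [hM, G, HasCompactSupport.toSchwartzMap_toFun, Pi.sub_apply, Complex.ofReal_inv]
    rw [mul_sub]
    rw [mul_inv_cancel_left₀ h0]
  choose M hM using key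
  refine ⟨M, tendsto_of_tendsto_of_tendsto_of_le_of_le tendsto_const_nhds ?_
    (fun _ => zero_le) hM⟩
  have := ENNReal.tendsto_ofReal (tendsto_one_div_add_atTop_nhds_zero_nat (𝕜 := ℝ))
  rwa [ENNReal.ofReal_zero] at this

/-! ### Fourier inversion and the Fourier transform in time -/

lemma norm_exp_neg_I_mul_mul (x y : ℝ) : ‖Complex.exp (-Complex.I * x * y)‖ = 1 := by
  rw [← norm_exp_I_mul_ofReal_mul x (-y)]
  congr 2; push_cast; ring

open FourierTransform in
lemma fourier1_inversion {f : ℝ → ℂ} (hc : Continuous f) (hf : Integrable f)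
    (hf' : Integrable (fourier1 f)) (t : ℝ) :
    f t = (2 * (Real.pi : ℂ))⁻¹ * ∫ τ : ℝ, Complex.exp (Complex.I * t * τ) * fourier1 f τ := by
  have e : fourier1 f = fun τ => 𝓕 f (τ / (2 * Real.pi)) := funext fun τ => fourier1_eq f τ
  have h1 : Integrable (𝓕 f) := by
    rw [e] at hf'
    exact (integrable_comp_div_iff _ Real.two_pi_pos.ne').1 hf'
  have h2 := congrFun (hc.fourierInv_fourier_eq hf h1) t
  rw [← h2, Real.fourierInv_eq']
  have h3 := Measure.integral_comp_div
    (fun υ : ℝ => Complex.exp (↑(2 * Real.pi * (υ * t)) * Complex.I) • 𝓕 f υ) (2 * Real.pi)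
  rw [abs_of_pos Real.two_pi_pos] at h3
  have h4 : ∫ τ : ℝ, Complex.exp (Complex.I * t * τ) * fourier1 f τ =
      (2 * Real.pi) • ∫ υ : ℝ, Complex.exp (↑(2 * Real.pi * (υ * t)) * Complex.I) • 𝓕 f υ := by
    rw [← h3]
    refine integral_congr_ae (Eventually.of_forall fun τ => ?_)
    simp only [smul_eq_mul, e]
    congr 2
    have : (Real.pi : ℂ) ≠ 0 := by exact_mod_cast Real.pi_ne_zero
    push_cast
    field_simp
  rw [h4, Complex.real_smul]
  have : (Real.pi : ℂ) ≠ 0 := by exact_mod_cast Real.pi_ne_zero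
  push_cast
  rw [inv_mul_cancel_left₀ (by simp)]
  refine integral_congr_ae (Eventually.of_forall fun υ => ?_)
  simp [mul_comm]

/-- The time Fourier transform `∫ e^{itυ} φ(x,t) dt` of a test function at `p = (x, υ)`. -/
def timeFourier (φ : 𝓢(ℝ × ℝ, ℂ)) (p : ℝ × ℝ) : ℂ :=
  ∫ t : ℝ, Complex.exp (Complex.I * t * p.2) * φ (p.1, t)

lemma integrable_decay_section {f : ℝ → ℂ} (hf : AEStronglyMeasurable f) {C : ℝ}
    (h : ∀ t, ‖f t‖ ≤ C * (1 + t ^ 2)⁻¹) : Integrable f :=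
  (integrable_inv_one_add_sq.const_mul C).mono' hf (Eventually.of_forall h)

lemma norm_schwartz_fst_le (φ : 𝓢(ℝ × ℝ, ℂ)) {C : ℝ} (hC : 0 ≤ C)
    (h : ∀ p, ‖φ p‖ ≤ C * ((1 + p.1 ^ 2)⁻¹ * (1 + p.2 ^ 2)⁻¹)) (x t : ℝ) :
    ‖φ (x, t)‖ ≤ C * (1 + t ^ 2)⁻¹ := by
  refine (h (x, t)).trans ?_
  have h1 : (1 + x ^ 2)⁻¹ ≤ 1 := inv_le_one_of_one_le₀ (by nlinarith [sq_nonneg x])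
  calc C * ((1 + x ^ 2)⁻¹ * (1 + t ^ 2)⁻¹) ≤ C * (1 * (1 + t ^ 2)⁻¹) := by gcongr
    _ = _ := by rw [one_mul]

lemma norm_schwartz_snd_le (φ : 𝓢(ℝ × ℝ, ℂ)) {C : ℝ} (hC : 0 ≤ C)
    (h : ∀ p, ‖φ p‖ ≤ C * ((1 + p.1 ^ 2)⁻¹ * (1 + p.2 ^ 2)⁻¹)) (x t : ℝ) :
    ‖φ (x, t)‖ ≤ C * (1 + x ^ 2)⁻¹ := by
  refine (h (x, t)).trans ?_
  have h1 : (1 + t ^ 2)⁻¹ ≤ 1 := inv_le_one_of_one_le₀ (by nlinarith [sq_nonneg t])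
  calc C * ((1 + x ^ 2)⁻¹ * (1 + t ^ 2)⁻¹) ≤ C * ((1 + x ^ 2)⁻¹ * 1) := by gcongr
    _ = _ := by rw [mul_one]

lemma integrable_schwartz_section (φ : 𝓢(ℝ × ℝ, ℂ)) (x : ℝ) :
    Integrable fun t => φ (x, t) := by
  obtain ⟨C, hC, h⟩ := exists_norm_schwartz_le φ
  exact integrable_decay_section (by fun_prop) (norm_schwartz_fst_le φ hC h x)

lemma integrable_exp_mul_section (φ : 𝓢(ℝ × ℝ, ℂ)) (x υ : ℝ) :
    Integrable fun t : ℝ => Complex.exp (Complex.I * t * υ) * φ (x, t) :=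
  (integrable_schwartz_section φ x).bdd_mul (c := 1) (by fun_prop)
    (Eventually.of_forall fun t => (norm_exp_I_mul_ofReal_mul t υ).le)

lemma timeFourier_eq_fourier1 (φ : 𝓢(ℝ × ℝ, ℂ)) (x υ : ℝ) :
    timeFourier φ (x, υ) = fourier1 (fun t => φ (x, t)) (-υ) := by
  rw [timeFourier, fourier1]
  refine integral_congr_ae (Eventually.of_forall fun t => ?_)
  simp

lemma norm_timeFourier_le (φ : 𝓢(ℝ × ℝ, ℂ)) {C : ℝ}
    (h : ∀ p, ‖φ p‖ ≤ C * ((1 + p.1 ^ 2)⁻¹ * (1 + p.2 ^ 2)⁻¹)) (p : ℝ × ℝ) :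
    ‖timeFourier φ p‖ ≤ Real.pi * C * (1 + p.1 ^ 2)⁻¹ := by
  have hb (t : ℝ) : ‖Complex.exp (Complex.I * t * p.2) * φ (p.1, t)‖ ≤
      (C * (1 + p.1 ^ 2)⁻¹) * (1 + t ^ 2)⁻¹ := by
    rw [norm_mul, norm_exp_I_mul_ofReal_mul, one_mul, mul_assoc]
    exact h (p.1, t)
  refine (norm_integral_le_of_norm_le (integrable_inv_one_add_sq.const_mul _)
    (Eventually.of_forall hb)).trans_eq ?_
  rw [integral_const_mul, integral_univ_inv_one_add_sq]
  ring

lemma stronglyMeasurable_timeFourier (φ : 𝓢(ℝ × ℝ, ℂ)) :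
    StronglyMeasurable (timeFourier φ) := by
  refine StronglyMeasurable.integral_prod_right (f := fun (p : ℝ × ℝ) (t : ℝ) =>
    Complex.exp (Complex.I * t * p.2) * φ (p.1, t)) (Continuous.stronglyMeasurable ?_)
  unfold Function.uncurry
  fun_prop

lemma timeFourier_add (φ ψ : 𝓢(ℝ × ℝ, ℂ)) (p : ℝ × ℝ) :
    timeFourier (φ + ψ) p = timeFourier φ p + timeFourier ψ p := by
  rw [timeFourier, timeFourier, timeFourier,
    ← integral_add (integrable_exp_mul_section φ _ _) (integrable_exp_mul_section ψ _ _)]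
  simp [mul_add]

lemma timeFourier_smul (c : ℂ) (φ : 𝓢(ℝ × ℝ, ℂ)) (p : ℝ × ℝ) :
    timeFourier (c • φ) p = c * timeFourier φ p := by
  rw [timeFourier, timeFourier, ← integral_const_mul]
  simp [mul_left_comm]

open LineDeriv in
/-- The time derivative of a Schwartz function. -/
def timeDeriv : 𝓢(ℝ × ℝ, ℂ) →L[ℂ] 𝓢(ℝ × ℝ, ℂ) := lineDerivOpCLM ℂ 𝓢(ℝ × ℝ, ℂ) ((0 : ℝ), (1 : ℝ))

lemma hasDerivAt_timeDeriv (φ : 𝓢(ℝ × ℝ, ℂ)) (x t : ℝ) :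
    HasDerivAt (fun t => φ (x, t)) (timeDeriv φ (x, t)) t := by
  have h1 : timeDeriv φ (x, t) = fderiv ℝ φ (x, t) (0, 1) :=
    SchwartzMap.lineDerivOp_apply_eq_fderiv (0, 1) φ (x, t)
  rw [h1]
  exact (φ.hasFDerivAt (x, t)).comp_hasDerivAt t ((hasDerivAt_const t x).prodMk (hasDerivAt_id t))

lemma timeFourier_timeDeriv (φ : 𝓢(ℝ × ℝ, ℂ)) (p : ℝ × ℝ) :
    timeFourier (timeDeriv φ) p = -(Complex.I * p.2) * timeFourier φ p := by
  have hu (t : ℝ) : HasDerivAt (fun t : ℝ => Complex.exp (Complex.I * t * p.2))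
      (Complex.I * p.2 * Complex.exp (Complex.I * t * p.2)) t := by
    have h1 : HasDerivAt (fun t : ℝ => Complex.I * t * p.2) (Complex.I * p.2) t := by
      have := ((Complex.ofRealCLM.hasDerivAt (x := t)).const_mul Complex.I).mul_const (p.2 : ℂ)
      simpa using this
    exact h1.cexp.congr_deriv (by ring)
  have h := integral_mul_deriv_eq_deriv_mul_of_integrable (u := fun t : ℝ =>
    Complex.exp (Complex.I * t * p.2)) (v := fun t => φ (p.1, t))
    (fun t _ => hu t) (fun t _ => hasDerivAt_timeDeriv φ p.1 t)
    (integrable_exp_mul_section (timeDeriv φ) p.1 p.2)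
    (((integrable_exp_mul_section φ p.1 p.2).const_mul (Complex.I * p.2)).congr
      (Eventually.of_forall fun t => by simp [mul_assoc]))
    (integrable_exp_mul_section φ p.1 p.2)
  rw [timeFourier, h, timeFourier, neg_mul, ← integral_const_mul]
  congr 2
  ext t
  ring

/-- The operator `1 - ∂ₜ²` on Schwartz functions. -/
def timeBessel : 𝓢(ℝ × ℝ, ℂ) →L[ℂ] 𝓢(ℝ × ℝ, ℂ) :=
  ContinuousLinearMap.id ℂ _ - timeDeriv.comp timeDeriv

lemma timeFourier_timeBessel (φ : 𝓢(ℝ × ℝ, ℂ)) (p : ℝ × ℝ) :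
    timeFourier (timeBessel φ) p = (1 + (p.2 : ℂ) ^ 2) * timeFourier φ p := by
  have : timeBessel φ = φ + (-1 : ℂ) • timeDeriv (timeDeriv φ) := by
    simp [timeBessel, sub_eq_add_neg]
  rw [this, timeFourier_add, timeFourier_smul, timeFourier_timeDeriv, timeFourier_timeDeriv]
  linear_combination (-(p.2 : ℂ) ^ 2 * timeFourier φ p) * Complex.I_sq

/-- Two time derivatives of the test function are traded for the decay (1+υ²)⁻¹. -/
lemma timeFourier_eq_timeBessel (φ : 𝓢(ℝ × ℝ, ℂ)) (p : ℝ × ℝ) :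
    timeFourier φ p = (((1 + p.2 ^ 2)⁻¹ : ℝ) : ℂ) * timeFourier (timeBessel φ) p := by
  have h : (1 + (p.2 : ℂ) ^ 2) ≠ 0 := by
    exact_mod_cast (show (1 + p.2 ^ 2 : ℝ) ≠ 0 by positivity)
  rw [timeFourier_timeBessel]
  push_cast
  rw [inv_mul_cancel_left₀ h]

lemma norm_inv_mul_timeFourier_le (φ : 𝓢(ℝ × ℝ, ℂ)) {C : ℝ}
    (h : ∀ p, ‖φ p‖ ≤ C * ((1 + p.1 ^ 2)⁻¹ * (1 + p.2 ^ 2)⁻¹)) (p : ℝ × ℝ) :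
    ‖(((1 + p.2 ^ 2)⁻¹ : ℝ) : ℂ) * timeFourier φ p‖ ≤
      Real.pi * C * ((1 + p.1 ^ 2)⁻¹ * (1 + p.2 ^ 2)⁻¹) := by
  rw [norm_mul, Complex.norm_real, Real.norm_of_nonneg (by positivity)]
  calc _ ≤ (1 + p.2 ^ 2)⁻¹ * (Real.pi * C * (1 + p.1 ^ 2)⁻¹) := by
        gcongr; exact norm_timeFourier_le φ h p
    _ = _ := by ring

lemma exists_norm_timeFourier_le (φ : 𝓢(ℝ × ℝ, ℂ)) : ∃ C : ℝ, 0 ≤ C ∧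
    ∀ p, ‖timeFourier φ p‖ ≤ C * ((1 + p.1 ^ 2)⁻¹ * (1 + p.2 ^ 2)⁻¹) := by
  obtain ⟨C, hC, h⟩ := exists_norm_schwartz_le (timeBessel φ)
  refine ⟨Real.pi * C, by positivity, fun p => ?_⟩
  rw [timeFourier_eq_timeBessel]
  exact norm_inv_mul_timeFourier_le _ h p

lemma integrable_timeFourier (φ : 𝓢(ℝ × ℝ, ℂ)) (x : ℝ) :
    Integrable fun υ => timeFourier φ (x, υ) := by
  obtain ⟨C, hC, h⟩ := exists_norm_timeFourier_le φ
  refine integrable_decay_section (C := C * (1 + x ^ 2)⁻¹)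
    ((stronglyMeasurable_timeFourier φ).comp_measurable
      measurable_prodMk_left).aestronglyMeasurable fun υ => ?_
  rw [mul_assoc]
  exact h (x, υ)

lemma schwartz_eq_integral_timeFourier (φ : 𝓢(ℝ × ℝ, ℂ)) (x t : ℝ) :
    φ (x, t) = (2 * (Real.pi : ℂ))⁻¹ *
      ∫ υ : ℝ, Complex.exp (-Complex.I * t * υ) * timeFourier φ (x, υ) := by
  have h1 : Integrable (fourier1 fun t => φ (x, t)) := by
    have := (integrable_timeFourier φ x).comp_neg
    simpa only [timeFourier_eq_fourier1, neg_neg] using this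
  rw [fourier1_inversion (f := fun t => φ (x, t)) (by fun_prop)
    (integrable_schwartz_section φ x) h1 t]
  congr 1
  rw [← integral_neg_eq_self]
  refine integral_congr_ae (Eventually.of_forall fun υ => ?_)
  simp only [timeFourier_eq_fourier1]
  congr 2
  push_cast; ring

/-! ### The Duhamel term of a Schwartz function -/

lemma fourier2_eq_fourier1 (M : 𝓢(ℝ × ℝ, ℂ)) (ξ τ : ℝ) :
    fourier2 M (ξ, τ) = fourier1 (fun t => fourier1 (fun y => M (y, t)) ξ) τ := by
  have hi : Integrable (fun p : ℝ × ℝ =>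
      Complex.exp (-Complex.I * (p.1 * ξ + p.2 * τ)) * M p) := by
    refine M.integrable.bdd_mul (c := 1) (by fun_prop) (Eventually.of_forall fun p => ?_)
    rw [show -Complex.I * (p.1 * ξ + p.2 * τ) =
      ((-(p.1 * ξ + p.2 * τ) : ℝ) : ℂ) * Complex.I by push_cast; ring,
      Complex.norm_exp_ofReal_mul_I]
  rw [fourier2, Measure.volume_eq_prod, integral_prod_symm _ hi, fourier1]
  refine integral_congr_ae (Eventually.of_forall fun t => ?_)
  simp only [fourier1]
  rw [← integral_const_mul]
  refine integral_congr_ae (Eventually.of_forall fun y => ?_)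
  simp only
  rw [← mul_assoc, ← Complex.exp_add]
  congr 2
  ring

lemma fourier1_section (M : 𝓢(ℝ × ℝ, ℂ)) (t ξ : ℝ) :
    fourier1 (fun y => M (y, t)) ξ = (2 * (Real.pi : ℂ))⁻¹ *
      ∫ τ : ℝ, Complex.exp (Complex.I * t * τ) * fourier2 M (ξ, τ) := by
  obtain ⟨C, hC, h⟩ := exists_norm_schwartz_le M
  have hb (s y : ℝ) : ‖Complex.exp (-Complex.I * y * ξ) * M (y, s)‖ ≤
      (C * (1 + s ^ 2)⁻¹) * (1 + y ^ 2)⁻¹ := by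
    rw [norm_mul, norm_exp_neg_I_mul_mul, one_mul]
    exact (h (y, s)).trans_eq (by ring)
  have hb' (s y : ℝ) : ‖Complex.exp (-Complex.I * y * ξ) * M (y, s)‖ ≤
      C * (1 + y ^ 2)⁻¹ := by
    rw [norm_mul, norm_exp_neg_I_mul_mul, one_mul]
    exact norm_schwartz_snd_le M hC h y s
  have hc : Continuous fun s => fourier1 (fun y => M (y, s)) ξ :=
    continuous_of_dominated (fun s => by fun_prop) (fun s => Eventually.of_forall (hb' s))
      (integrable_inv_one_add_sq.const_mul C) (Eventually.of_forall fun y => by fun_prop)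
  have hi : Integrable fun s => fourier1 (fun y => M (y, s)) ξ := by
    refine integrable_decay_section (C := C * Real.pi) hc.aestronglyMeasurable fun s => ?_
    refine (norm_integral_le_of_norm_le (integrable_inv_one_add_sq.const_mul _)
      (Eventually.of_forall (hb s))).trans_eq ?_
    rw [integral_const_mul, integral_univ_inv_one_add_sq]
    ring
  obtain ⟨G, hG⟩ := exists_fourier2_schwartz M
  have hi' : Integrable (fourier1 fun s => fourier1 (fun y => M (y, s)) ξ) := by
    refine (integrable_schwartz_section G ξ).congr (Eventually.of_forall fun τ => ?_)
    simp only [hG, fourier2_eq_fourier1]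
  rw [fourier1_inversion (f := fun s => fourier1 (fun y => M (y, s)) ξ) hc hi hi' t]
  simp_rw [fourier2_eq_fourier1]

lemma norm_exp_cube_mul_exp (r x : ℝ) (t : ℝ) (q : ℝ × ℝ) :
    ‖Complex.exp (Complex.I * x * q.1) * (Complex.exp (Complex.I * r * (q.1 : ℂ) ^ 3) *
      Complex.exp (Complex.I * t * q.2))‖ = 1 := by
  rw [norm_mul, norm_mul, norm_exp_I_mul_ofReal_mul, norm_exp_I_mul_ofReal_mul,
    ← Complex.ofReal_pow, norm_exp_I_mul_ofReal_mul]
  norm_num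

lemma airyGroup_schwartz (M : 𝓢(ℝ × ℝ, ℂ)) (r t x : ℝ) :
    airyGroup r (fun y => M (y, t)) x = ((2 * (Real.pi : ℂ)) ^ 2)⁻¹ *
      ∫ q : ℝ × ℝ, Complex.exp (Complex.I * x * q.1) *
        (Complex.exp (Complex.I * r * (q.1 : ℂ) ^ 3) * Complex.exp (Complex.I * t * q.2)) *
          fourier2 M q := by
  obtain ⟨G, hG⟩ := exists_fourier2_schwartz M
  have hi : Integrable fun q : ℝ × ℝ => Complex.exp (Complex.I * x * q.1) *
        (Complex.exp (Complex.I * r * (q.1 : ℂ) ^ 3) * Complex.exp (Complex.I * t * q.2)) *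
          fourier2 M q := by
    simp_rw [← hG]
    exact G.integrable.bdd_mul (c := 1) (by fun_prop)
      (Eventually.of_forall fun q => (norm_exp_cube_mul_exp r x t q).le)
  rw [airyGroup, Measure.volume_eq_prod, integral_prod _ hi,
    show ((2 * (Real.pi : ℂ)) ^ 2)⁻¹ = (2 * (Real.pi : ℂ))⁻¹ * (2 * (Real.pi : ℂ))⁻¹ by
      rw [sq, mul_inv], mul_assoc]
  congr 1
  rw [← integral_const_mul]
  refine integral_congr_ae (Eventually.of_forall fun ξ => ?_)
  simp only [fourier1_section]
  rw [mul_left_comm (Complex.exp (Complex.I * r * (ξ : ℂ) ^ 3)), mul_left_comm]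
  congr 1
  rw [← integral_const_mul, ← integral_const_mul]
  refine integral_congr_ae (Eventually.of_forall fun τ => ?_)
  simp only
  ring

/-- On the Fourier side the variable t' occurs only in exponentials, so Fubini leaves the explicit
oscillating integral. -/
lemma duhamel_schwartz (η : ℝ → ℝ) (M : 𝓢(ℝ × ℝ, ℂ)) (p : ℝ × ℝ) :
    duhamel η M p = η p.2 * (((2 * (Real.pi : ℂ)) ^ 2)⁻¹ *
      ∫ q : ℝ × ℝ, Complex.exp (Complex.I * p.1 * q.1) *
        (duhamelPhase p.2 q * fourier2 M q)) := by
  obtain ⟨G, hG⟩ := exists_fourier2_schwartz M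
  rw [duhamel]
  congr 1
  simp_rw [airyGroup_schwartz, ← hG]
  rw [intervalIntegral.integral_const_mul]
  congr 1
  rw [intervalIntegral_integral_swap]
  · refine integral_congr_ae (Eventually.of_forall fun q => ?_)
    simp only [duhamelPhase]
    rw [← intervalIntegral.integral_mul_const, ← intervalIntegral.integral_const_mul]
    refine intervalIntegral.integral_congr fun t' _ => ?_
    ring
  · have : IsFiniteMeasure (volume.restrict (Set.uIoc 0 p.2)) :=
      ⟨by rw [Measure.restrict_apply_univ, Set.uIoc]; exact measure_Ioc_lt_top⟩
    have h1 : Integrable (fun z : ℝ × (ℝ × ℝ) => (1 : ℂ) * G z.2)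
        ((volume.restrict (Set.uIoc 0 p.2)).prod volume) :=
      Integrable.mul_prod (integrable_const _) G.integrable
    simp_rw [one_mul] at h1
    exact h1.bdd_mul (c := 1) (by fun_prop)
      (Eventually.of_forall fun z => (norm_exp_cube_mul_exp _ _ _ _).le)

/-- The function `∬ e^{ixξ} m(υ,ξ,τ) F(ξ,τ) dξ dτ / (2π)²` of `p = (x, υ)`, where `m` is the
Duhamel symbol: the time Fourier transform of the Duhamel term. -/
def duhamelTime (h : ℝ → ℂ) (F : ℝ × ℝ → ℂ) (p : ℝ × ℝ) : ℂ :=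
  ((2 * (Real.pi : ℂ)) ^ 2)⁻¹ *
    ∫ q : ℝ × ℝ, Complex.exp (Complex.I * p.1 * q.1) * (duhamelSymbol h p.2 q * F q)

lemma norm_duhamel_integrand_le (h : 𝓢(ℝ, ℂ)) (G : ℝ × ℝ → ℂ) (x t : ℝ) (q : ℝ × ℝ) :
    ‖Complex.exp (Complex.I * x * q.1) * (h t * (duhamelPhase t q * G q))‖ ≤
      ‖t * h t‖ * ‖G q‖ := by
  rw [norm_mul, norm_exp_I_mul_ofReal_mul, one_mul, norm_mul, norm_mul, norm_mul,
    Complex.norm_real, Real.norm_eq_abs]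
  calc _ ≤ ‖h t‖ * (|t| * ‖G q‖) := by gcongr; exact norm_duhamelPhase_le t q
    _ = _ := by ring

@[fun_prop]
lemma measurable_duhamelPhase_comp {α : Type*} [MeasurableSpace α] {f : α → ℝ} {g : α → ℝ × ℝ}
    (hf : Measurable f) (hg : Measurable g) : Measurable fun a => duhamelPhase (f a) (g a) := by
  have h := measurable_duhamelPhase.comp (hf.prodMk hg)
  exact h

lemma measurable_duhamel_integrand (h : 𝓢(ℝ, ℂ)) (G : 𝓢(ℝ × ℝ, ℂ)) :
    Measurable fun z : (ℝ × ℝ) × (ℝ × ℝ) =>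
      Complex.exp (Complex.I * z.1.1 * z.2.1) * (h z.1.2 * (duhamelPhase z.1.2 z.2 * G z.2)) := by
  fun_prop

lemma integrable_duhamel_integrand (h : 𝓢(ℝ, ℂ)) (G : 𝓢(ℝ × ℝ, ℂ)) (x υ : ℝ) :
    Integrable fun z : ℝ × (ℝ × ℝ) => Complex.exp (-Complex.I * z.1 * υ) *
      (Complex.exp (Complex.I * x * z.2.1) * (h z.1 * (duhamelPhase z.1 z.2 * G z.2))) := by
  obtain ⟨g, hg⟩ := exists_mul_schwartz h
  have h1 : Integrable (fun z : ℝ × (ℝ × ℝ) => ‖g z.1‖ * ‖G z.2‖) :=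
    g.integrable.norm.mul_prod G.integrable.norm
  refine h1.mono' (Measurable.aestronglyMeasurable (by fun_prop))
    (Eventually.of_forall fun z => ?_)
  rw [norm_mul, norm_exp_neg_I_mul_mul, one_mul, hg]
  exact norm_duhamel_integrand_le h G x z.1 z.2

lemma duhamel_schwartz' {η : ℝ → ℝ} {h : 𝓢(ℝ, ℂ)} (hη : ∀ t, h t = η t) {M G : 𝓢(ℝ × ℝ, ℂ)}
    (hG : ∀ q, G q = fourier2 M q) (p : ℝ × ℝ) :
    duhamel η M p = ((2 * (Real.pi : ℂ)) ^ 2)⁻¹ *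
      ∫ q : ℝ × ℝ, Complex.exp (Complex.I * p.1 * q.1) * (h p.2 * (duhamelPhase p.2 q * G q)) := by
  rw [duhamel_schwartz, ← hη, mul_left_comm, ← integral_const_mul]
  congr 1
  refine integral_congr_ae (Eventually.of_forall fun q => ?_)
  simp only [hG]
  ring

lemma stronglyMeasurable_duhamel {η : ℝ → ℝ} {h : 𝓢(ℝ, ℂ)} (hη : ∀ t, h t = η t)
    (M : 𝓢(ℝ × ℝ, ℂ)) : StronglyMeasurable (duhamel η M) := by
  obtain ⟨G, hG⟩ := exists_fourier2_schwartz M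
  rw [show duhamel η M = _ from funext (duhamel_schwartz' hη hG)]
  exact (measurable_duhamel_integrand h G).stronglyMeasurable.integral_prod_right'.const_mul _

lemma exists_norm_duhamel_le {η : ℝ → ℝ} {h : 𝓢(ℝ, ℂ)} (hη : ∀ t, h t = η t)
    (M : 𝓢(ℝ × ℝ, ℂ)) : ∃ C : ℝ, 0 ≤ C ∧ ∀ p, ‖duhamel η M p‖ ≤ C * ‖p.2 * h p.2‖ := by
  obtain ⟨G, hG⟩ := exists_fourier2_schwartz M
  refine ⟨‖((2 * (Real.pi : ℂ)) ^ 2)⁻¹‖ * ∫ q, ‖G q‖, by positivity, fun p => ?_⟩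
  rw [duhamel_schwartz' hη hG, norm_mul, mul_assoc]
  gcongr
  refine (norm_integral_le_of_norm_le (G.integrable.norm.const_mul _)
    (Eventually.of_forall fun q => norm_duhamel_integrand_le h G p.1 p.2 q)).trans_eq ?_
  rw [integral_const_mul, mul_comm]

/-- `duhamelTime` is the time Fourier transform of the Duhamel term of a Schwartz function. -/
lemma duhamelTime_schwartz {η : ℝ → ℝ} {h : 𝓢(ℝ, ℂ)} (hη : ∀ t, h t = η t)
    (M : 𝓢(ℝ × ℝ, ℂ)) (x υ : ℝ) :
    duhamelTime h (fourier2 M) (x, υ) =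
      ∫ t : ℝ, Complex.exp (-Complex.I * t * υ) * duhamel η M (x, t) := by
  obtain ⟨G, hG⟩ := exists_fourier2_schwartz M
  simp_rw [duhamel_schwartz' hη hG, mul_left_comm _ ((2 * (Real.pi : ℂ)) ^ 2)⁻¹]
  rw [integral_const_mul, duhamelTime]
  congr 1
  simp_rw [← integral_const_mul]
  rw [integral_integral_swap (integrable_duhamel_integrand h G x υ)]
  refine integral_congr_ae (Eventually.of_forall fun q => ?_)
  simp only
  rw [← integral_mul_duhamelPhase, ← integral_mul_const, ← integral_const_mul, ← hG]
  refine integral_congr_ae (Eventually.of_forall fun t => ?_)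
  simp only
  ring

/-- Parseval identity in time for the Duhamel term of a Schwartz function. -/
theorem integral_duhamel_mul {η : ℝ → ℝ} {h : 𝓢(ℝ, ℂ)} (hη : ∀ t, h t = η t)
    (M φ : 𝓢(ℝ × ℝ, ℂ))
    (hi : Integrable fun p => duhamelTime h (fourier2 M) p * timeFourier φ p) :
    ∫ p, duhamel η M p * φ p = (2 * (Real.pi : ℂ))⁻¹ *
      ∫ p, duhamelTime h (fourier2 M) p * timeFourier φ p := by
  obtain ⟨C, hC, hb⟩ := exists_norm_duhamel_le hη M
  obtain ⟨g, hg⟩ := exists_mul_schwartz h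
  simp_rw [← hg] at hb
  have hm := stronglyMeasurable_duhamel hη M
  have hi2 : Integrable fun p => duhamel η M p * φ p := by
    refine φ.integrable.bdd_mul (c := C * SchwartzMap.seminorm ℂ 0 0 g) hm.aestronglyMeasurable
      (Eventually.of_forall fun p => (hb p).trans ?_)
    gcongr
    exact g.norm_le_seminorm ℂ p.2
  rw [Measure.volume_eq_prod] at hi hi2 ⊢
  -- The identity holds for each fixed x: insert the inversion formula for φ(x,·) and exchange the
  -- integrals in t and υ.
  rw [integral_prod _ hi, integral_prod _ hi2, ← integral_const_mul]
  refine integral_congr_ae (Eventually.of_forall fun x => ?_)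
  simp only [duhamelTime_schwartz hη, schwartz_eq_integral_timeFourier φ x]
  simp_rw [mul_left_comm _ (2 * (Real.pi : ℂ))⁻¹]
  rw [integral_const_mul]
  congr 1
  simp_rw [← integral_const_mul, ← integral_mul_const]
  have hD : Integrable fun t => duhamel η M (x, t) :=
    (g.integrable.norm.const_mul C).mono'
      (hm.comp_measurable measurable_prodMk_left).aestronglyMeasurable
      (Eventually.of_forall fun t => hb (x, t))
  have h2 : Integrable (fun z : ℝ × ℝ => Complex.exp (-Complex.I * z.1 * z.2) *
      (duhamel η M (x, z.1) * timeFourier φ (x, z.2))) := by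
    refine (hD.mul_prod (integrable_timeFourier φ x)).bdd_mul (c := 1) (by fun_prop)
      (Eventually.of_forall fun z => (norm_exp_neg_I_mul_mul z.1 z.2).le)
  have h3 : Integrable (Function.uncurry fun t υ : ℝ =>
      duhamel η M (x, t) * (Complex.exp (-Complex.I * t * υ) * timeFourier φ (x, υ))) :=
    h2.congr (Eventually.of_forall fun z => by simp only [Function.uncurry]; ring)
  rw [integral_integral_swap h3]
  refine integral_congr_ae (Eventually.of_forall fun υ => ?_)
  refine integral_congr_ae (Eventually.of_forall fun t => ?_)
  simp only
  ring

/-! ### Norm bounds for the Duhamel term -/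

lemma ennreal_le_of_sq_le {a b : ℝ≥0∞} {C : ℝ≥0} (h : a ^ 2 ≤ C * b ^ 2) :
    a ≤ NNReal.sqrt C * b := by
  refine (ENNReal.pow_le_pow_left_iff two_ne_zero).1 (h.trans_eq ?_)
  rw [mul_pow, ← ENNReal.coe_pow, NNReal.sq_sqrt]

lemma eLpNorm_two_sq {α : Type*} [MeasurableSpace α] {E : Type*} [NormedAddCommGroup E]
    (μ : Measure α) (f : α → E) : eLpNorm f 2 μ ^ 2 = ∫⁻ x, ‖f x‖ₑ ^ 2 ∂μ := by
  have h := eLpNorm_nnreal_pow_eq_lintegral (f := f) (μ := μ) (p := 2) two_ne_zero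
  have h2 : ((2 : ℝ≥0) : ℝ) = ((2 : ℕ) : ℝ) := by norm_num
  simp only [h2, ENNReal.rpow_natCast] at h
  exact h

lemma enorm_jb_rpow (p x : ℝ) : ‖jb x ^ p‖ₑ = jbw p x := by
  rw [Real.enorm_of_nonneg (Real.rpow_nonneg (jb_nonneg x) p), jbw]

lemma xNorm_sq (s b : ℝ) (F : ℝ × ℝ → ℂ) :
    xNorm s (-b) F ^ 2 = energy s b fun q => ‖F q‖ₑ := by
  rw [xNorm, eLpNorm_two_sq, energy]
  refine lintegral_congr fun q => ?_
  rw [enorm_mul, enorm_mul, enorm_jb_rpow, enorm_jb_rpow, enorm_norm, mul_pow, mul_pow,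
    jbw_pow_two, jbw_pow_two, show 2 * -b = -2 * b by ring]

lemma energy_congr (s b : ℝ) {f g : ℝ × ℝ → ℝ≥0∞} (h : f =ᵐ[volume] g) :
    energy s b f = energy s b g := by
  refine lintegral_congr_ae ?_
  filter_upwards [h] with q hq
  rw [hq]

lemma corrNorm_sq (K s : ℝ) {F : ℝ × ℝ → ℂ} {f : ℝ × ℝ → ℝ≥0∞}
    (h : (fun q => ‖F q‖ₑ) =ᵐ[volume] f) :
    corrNorm K s F ^ 2 = ∫⁻ τ, (∫⁻ ξ, (regionR K).indicator
      (fun q => jbw ((s - 2) / 3) (q.2 - q.1 ^ 3) * f q) (ξ, τ)) ^ 2 := by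
  rw [corrNorm, ← ENNReal.rpow_natCast, ← ENNReal.rpow_mul]
  norm_num
  have h1 : ∀ᵐ τ : ℝ, ∀ᵐ ξ : ℝ, ‖F (ξ, τ)‖ₑ = f (ξ, τ) := by
    -- The sections are taken at fixed τ, the second coordinate, so the null set is swapped first.
    have h2 := Measure.measurePreserving_swap.quasiMeasurePreserving.ae
      (μa := (volume : Measure ℝ).prod (volume : Measure ℝ)) h
    exact Measure.ae_ae_of_ae_prod h2
  refine lintegral_congr_ae ?_
  filter_upwards [h1] with τ hτ
  congr 1
  refine lintegral_congr_ae ?_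
  filter_upwards [hτ] with ξ hξ
  by_cases hq : (ξ, τ) ∈ regionR K
  · simp only [Set.indicator_of_mem hq]
    rw [ENNReal.ofReal_mul (Real.rpow_nonneg (jb_nonneg _) _), ofReal_norm, hξ, jbw]
  · simp [hq]

/-- The majorant, uniform in `x`, of the time Fourier transform of the Duhamel term. -/
def duhamelMajorant (h : ℝ → ℂ) (F : ℝ × ℝ → ℂ) (υ : ℝ) : ℝ≥0∞ :=
  ∫⁻ q, ‖duhamelSymbol h υ q‖ₑ * ‖F q‖ₑ

@[fun_prop]
lemma measurable_duhamelSymbol_comp (h : 𝓢(ℝ, ℂ)) {α : Type*} [MeasurableSpace α] {f : α → ℝ}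
    {g : α → ℝ × ℝ} (hf : Measurable f) (hg : Measurable g) :
    Measurable fun a => duhamelSymbol h (f a) (g a) := by
  have h := (measurable_duhamelSymbol h).comp (hf.prodMk hg)
  exact h

lemma measurable_duhamelMajorant (h : 𝓢(ℝ, ℂ)) {F : ℝ × ℝ → ℂ}
    (hF : AEStronglyMeasurable F volume) : Measurable (duhamelMajorant h F) := by
  obtain ⟨f, hf, hfF⟩ := hF.enorm
  have : duhamelMajorant h F = fun υ => ∫⁻ q, ‖duhamelSymbol h υ q‖ₑ * f q := by
    ext υ
    refine lintegral_congr_ae ?_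
    filter_upwards [hfF] with q hq
    rw [hq]
  rw [this]
  exact Measurable.lintegral_prod_right'
    (f := fun z : ℝ × (ℝ × ℝ) => ‖duhamelSymbol h z.1 z.2‖ₑ * f z.2) (by fun_prop)

lemma exists_duhamelMajorant_le (h : 𝓢(ℝ, ℂ)) {A : ℝ} (hA : 0 ≤ A) : ∃ C : ℝ≥0,
    ∀ (F : ℝ × ℝ → ℂ) (f : ℝ × ℝ → ℝ≥0∞), (fun q => ‖F q‖ₑ) =ᵐ[volume] f → ∀ p υ,
      jbw p υ * duhamelMajorant h F υ ^ 2 ≤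
        C * (jbw p υ * (∫⁻ q, kernelBound A υ q * f q) ^ 2) := by
  obtain ⟨C, hC⟩ := exists_enorm_duhamelSymbol_le h hA
  refine ⟨C ^ 2, fun F f hf p υ => ?_⟩
  have h1 : duhamelMajorant h F υ ≤ C * ∫⁻ q, kernelBound A υ q * f q := by
    rw [← lintegral_const_mul' _ _ ENNReal.coe_ne_top]
    refine lintegral_mono_ae ?_
    filter_upwards [hf] with q hq
    rw [hq, ← mul_assoc]
    exact mul_le_mul_left (hC υ q) _
  calc _ ≤ jbw p υ * (C * ∫⁻ q, kernelBound A υ q * f q) ^ 2 := by gcongr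
    _ = _ := by rw [mul_pow]; push_cast; ring

theorem exists_lintegral_duhamelMajorant_le (h : 𝓢(ℝ, ℂ)) {s b : ℝ} (hb : b < 1 / 2)
    (hs : -1 ≤ s) (hs' : s ≤ 2 - 3 * b) : ∃ C : ℝ≥0, ∀ F : ℝ × ℝ → ℂ,
    AEStronglyMeasurable F volume →
      ∫⁻ υ, jbw (2 * ((s + 1) / 3)) υ * duhamelMajorant h F υ ^ 2 ≤ C * xNorm s (-b) F ^ 2 := by
  obtain ⟨C₁, hC₁⟩ := exists_duhamelMajorant_le h
    -- Any decay rate is available for a Schwartz cutoff; the smallest one admitted by the kernel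
    -- estimate is taken.
    (A := |2 * ((s + 1) / 3)| + 3) (by positivity)
  obtain ⟨C₂, hC₂⟩ := exists_lintegral_sq_kernelBound hb hs hs' le_rfl
  refine ⟨C₁ * C₂, fun F hF => ?_⟩
  obtain ⟨f, hf, hfF⟩ := hF.enorm
  refine (lintegral_mono (hC₁ F f hfF _)).trans ?_
  rw [lintegral_const_mul' _ _ ENNReal.coe_ne_top, xNorm_sq, energy_congr _ _ hfF,
    ENNReal.coe_mul, mul_assoc]
  exact mul_le_mul_right (hC₂ f hf) _

theorem exists_lintegral_duhamelMajorant_le_add (h : 𝓢(ℝ, ℂ)) {s b K : ℝ} (hb : b < 1 / 2)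
    (hs : 0 ≤ s) (hK : 1 < K) : ∃ C : ℝ≥0, ∀ F : ℝ × ℝ → ℂ, AEStronglyMeasurable F volume →
      ∫⁻ υ, jbw (2 * ((s + 1) / 3)) υ * duhamelMajorant h F υ ^ 2 ≤
        C * (xNorm s (-b) F + corrNorm K s F) ^ 2 := by
  obtain ⟨C₁, hC₁⟩ := exists_duhamelMajorant_le h
    (A := |2 * ((s + 1) / 3)| + 3) (by positivity)
  obtain ⟨C₂, hC₂⟩ := exists_lintegral_sq_kernelBound_add hb hs hK le_rfl
  refine ⟨C₁ * C₂, fun F hF => ?_⟩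
  obtain ⟨f, hf, hfF⟩ := hF.enorm
  refine (lintegral_mono (hC₁ F f hfF _)).trans ?_
  rw [lintegral_const_mul' _ _ ENNReal.coe_ne_top, ENNReal.coe_mul, mul_assoc]
  refine mul_le_mul_right ((hC₂ f hf).trans (mul_le_mul_right ?_ _)) _
  rw [← corrNorm_sq K s hfF, ← energy_congr _ _ hfF, ← xNorm_sq, add_sq]
  gcongr
  exact le_self_add

/-- Since |e^{ixξ}| = 1 the bound does not see x; this is the source of the supremum over x. -/
lemma enorm_duhamelTime_le (h : ℝ → ℂ) (F : ℝ × ℝ → ℂ) (p : ℝ × ℝ) :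
    ‖duhamelTime h F p‖ₑ ≤ duhamelMajorant h F p.2 := by
  rw [duhamelTime, enorm_mul]
  have h1 : ‖((2 * (Real.pi : ℂ)) ^ 2)⁻¹‖ₑ ≤ 1 := by
    rw [← ofReal_norm, ENNReal.ofReal_le_one, norm_inv, norm_pow, norm_mul, Complex.norm_real,
      Real.norm_of_nonneg Real.pi_pos.le, Complex.norm_ofNat]
    exact inv_le_one_of_one_le₀ (one_le_pow₀ (by linarith [Real.pi_gt_three]))
  refine (mul_le_of_le_one_left' h1).trans ((enorm_integral_le_lintegral_enorm _).trans_eq ?_)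
  refine lintegral_congr fun q => ?_
  rw [enorm_mul, enorm_mul, ← ofReal_norm, norm_exp_I_mul_ofReal_mul, ENNReal.ofReal_one, one_mul]

lemma eLpNorm_duhamelTime_sq_le (h : ℝ → ℂ) (F : ℝ × ℝ → ℂ) (σ x : ℝ) :
    eLpNorm (fun τ : ℝ => jb τ ^ σ * ‖duhamelTime h F (x, τ)‖) 2 volume ^ 2 ≤
      ∫⁻ υ, jbw (2 * σ) υ * duhamelMajorant h F υ ^ 2 := by
  rw [eLpNorm_two_sq]
  refine lintegral_mono fun υ => ?_
  rw [enorm_mul, enorm_norm, enorm_jb_rpow, mul_pow, jbw_pow_two]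
  gcongr
  exact enorm_duhamelTime_le h F (x, υ)

lemma aestronglyMeasurable_duhamelTime_integrand (h : 𝓢(ℝ, ℂ)) {F : ℝ × ℝ → ℂ}
    (hF : AEStronglyMeasurable F volume) : AEStronglyMeasurable
      (fun z : (ℝ × ℝ) × (ℝ × ℝ) => Complex.exp (Complex.I * z.1.1 * z.2.1) *
        (duhamelSymbol h z.1.2 z.2 * F z.2)) (volume.prod volume) := by
  have h1 : AEStronglyMeasurable (fun z : (ℝ × ℝ) × (ℝ × ℝ) => F z.2) (volume.prod volume) :=
    hF.comp_snd
  refine AEStronglyMeasurable.mul (by fun_prop) (AEStronglyMeasurable.mul ?_ h1)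
  exact Measurable.aestronglyMeasurable (by fun_prop)

lemma aestronglyMeasurable_duhamelTime (h : 𝓢(ℝ, ℂ)) {F : ℝ × ℝ → ℂ}
    (hF : AEStronglyMeasurable F volume) : AEStronglyMeasurable (duhamelTime h F) volume :=
  (aestronglyMeasurable_duhamelTime_integrand h hF).integral_prod_right'.const_mul _

lemma ofReal_inv_one_add_sq (x : ℝ) : ENNReal.ofReal (1 + x ^ 2)⁻¹ = jbw (-2) x := by
  rw [jbw, ← jb_sq, Real.rpow_neg (jb_nonneg x)]
  norm_cast

/-- Pairing of the Duhamel term with a decaying function of `(x, υ)`. -/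
theorem exists_lintegral_duhamelTime_mul_le (h : 𝓢(ℝ, ℂ)) {b : ℝ} (hb : b < 1 / 2) :
    ∃ K : ℝ≥0, ∀ F : ℝ × ℝ → ℂ, AEStronglyMeasurable F volume →
      ∀ (u : ℝ × ℝ → ℂ) (C : ℝ), 0 ≤ C →
      (∀ p, ‖u p‖ ≤ C * ((1 + p.1 ^ 2)⁻¹ * (1 + p.2 ^ 2)⁻¹)) →
      ∫⁻ p, ‖duhamelTime h F p * u p‖ₑ ≤ ENNReal.ofReal C * K * xNorm (-1) (-b) F := by
  -- At s = -1 one has σ = 0: the majorant is in unweighted L², and this weakest norm controls every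
  -- s ≥ -1.
  obtain ⟨C₁, hC₁⟩ := exists_lintegral_duhamelMajorant_le h (s := -1) hb le_rfl (by linarith)
  obtain ⟨C₂, hC₂⟩ := exists_lintegral_jbw (β := 2) one_lt_two
  obtain ⟨C₄, hC₄⟩ := exists_lintegral_jbw (β := 4) (by norm_num)
  refine ⟨C₂ * NNReal.sqrt (C₁ * C₄), fun F hF u C hC hu => ?_⟩
  have hm := measurable_duhamelMajorant h hF
  have h1 (p : ℝ × ℝ) : ‖duhamelTime h F p * u p‖ₑ ≤
      ENNReal.ofReal C * (jbw (-2) p.1 * (duhamelMajorant h F p.2 * jbw (-2) p.2)) := by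
    have h2 : ‖u p‖ₑ ≤ ENNReal.ofReal C * (jbw (-2) p.1 * jbw (-2) p.2) := by
      rw [← ofReal_norm, ← ofReal_inv_one_add_sq, ← ofReal_inv_one_add_sq,
        ← ENNReal.ofReal_mul (by positivity), ← ENNReal.ofReal_mul hC]
      exact ENNReal.ofReal_le_ofReal (hu p)
    rw [enorm_mul]
    calc _ ≤ duhamelMajorant h F p.2 * (ENNReal.ofReal C * (jbw (-2) p.1 * jbw (-2) p.2)) := by
          gcongr
          exact enorm_duhamelTime_le h F p
      _ = _ := by ring
  have h3 : ∫⁻ υ, duhamelMajorant h F υ * jbw (-2) υ ≤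
      NNReal.sqrt (C₁ * C₄) * xNorm (-1) (-b) F := by
    refine ennreal_le_of_sq_le ((lintegral_mul_sq_le hm.aemeasurable (by fun_prop)).trans ?_)
    have h4 := hC₁ F hF
    simp_rw [show (2 : ℝ) * ((-1 + 1) / 3) = 0 by norm_num, jbw_zero, one_mul] at h4
    simp_rw [jbw_pow_two, show (2 : ℝ) * -2 = -4 by norm_num]
    rw [hC₄]
    calc _ ≤ (C₁ * xNorm (-1) (-b) F ^ 2) * C₄ := by gcongr
      _ = _ := by push_cast; ring
  refine (lintegral_mono h1).trans ?_
  rw [lintegral_const_mul' _ _ ENNReal.ofReal_ne_top, Measure.volume_eq_prod,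
    lintegral_prod_mul (f := jbw (-2)) (g := fun υ => duhamelMajorant h F υ * jbw (-2) υ)
      (by fun_prop) (by fun_prop), hC₂, mul_assoc]
  refine mul_le_mul_right ?_ _
  rw [ENNReal.coe_mul, mul_assoc]
  exact mul_le_mul_right h3 _

/-! ### The Duhamel term as a tempered distribution -/

lemma integrable_duhamelTime_mul (h : 𝓢(ℝ, ℂ)) {b : ℝ} (hb : b < 1 / 2) {F : ℝ × ℝ → ℂ}
    (hF : AEStronglyMeasurable F volume) (hF' : xNorm (-1) (-b) F < ⊤) {u : ℝ × ℝ → ℂ}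
    (hm : StronglyMeasurable u) {C : ℝ} (hC : 0 ≤ C)
    (hu : ∀ p, ‖u p‖ ≤ C * ((1 + p.1 ^ 2)⁻¹ * (1 + p.2 ^ 2)⁻¹)) :
    Integrable fun p => duhamelTime h F p * u p := by
  obtain ⟨K, hK⟩ := exists_lintegral_duhamelTime_mul_le h hb
  refine ⟨(aestronglyMeasurable_duhamelTime h hF).mul hm.aestronglyMeasurable, ?_⟩
  exact (hK F hF u C hC hu).trans_lt
    (ENNReal.mul_lt_top (ENNReal.mul_lt_top ENNReal.ofReal_lt_top ENNReal.coe_lt_top) hF')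

lemma integrable_duhamelTime_mul_timeFourier (h : 𝓢(ℝ, ℂ)) {b : ℝ} (hb : b < 1 / 2)
    {F : ℝ × ℝ → ℂ} (hF : AEStronglyMeasurable F volume) (hF' : xNorm (-1) (-b) F < ⊤)
    (φ : 𝓢(ℝ × ℝ, ℂ)) : Integrable fun p => duhamelTime h F p * timeFourier φ p := by
  obtain ⟨C, hC, hφ⟩ := exists_norm_timeFourier_le φ
  exact integrable_duhamelTime_mul h hb hF hF' (stronglyMeasurable_timeFourier φ) hC hφ

/-- The tempered distribution whose time Fourier transform is `duhamelTime h F`. -/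
theorem exists_duhamel_distribution (h : 𝓢(ℝ, ℂ)) {b : ℝ} (hb : b < 1 / 2) {F : ℝ × ℝ → ℂ}
    (hF : AEStronglyMeasurable F volume) (hF' : xNorm (-1) (-b) F < ⊤) :
    ∃ U : 𝓢'(ℝ × ℝ, ℂ), ∀ φ : 𝓢(ℝ × ℝ, ℂ), U φ = (2 * (Real.pi : ℂ))⁻¹ *
      ∫ p, duhamelTime h F p * timeFourier φ p := by
  obtain ⟨K, hK⟩ := exists_lintegral_duhamelTime_mul_le h hb
  -- With the decay in υ supplied by the factor (1+υ²)⁻¹, the pairing V is bounded by Schwartz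
  -- seminorms of φ. Composing V with `timeBessel` cancels that factor and gives the wanted
  -- functional.
  set u : 𝓢(ℝ × ℝ, ℂ) → ℝ × ℝ → ℂ := fun φ p => (((1 + p.2 ^ 2)⁻¹ : ℝ) : ℂ) * timeFourier φ p
  have hum (φ : 𝓢(ℝ × ℝ, ℂ)) : StronglyMeasurable (u φ) :=
    StronglyMeasurable.mul (Measurable.stronglyMeasurable (by fun_prop))
      (stronglyMeasurable_timeFourier φ)
  have hub (φ : 𝓢(ℝ × ℝ, ℂ)) := norm_inv_mul_timeFourier_le φ (norm_schwartz_le φ)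
  have hi (φ : 𝓢(ℝ × ℝ, ℂ)) : Integrable fun p => duhamelTime h F p * u φ p :=
    integrable_duhamelTime_mul h hb hF hF' (hum φ) (by positivity) (hub φ)
  let V : 𝓢(ℝ × ℝ, ℂ) →L[ℂ] ℂ := SchwartzMap.mkCLMtoNormedSpace (𝕜 := ℂ)
    (fun φ => ∫ p, duhamelTime h F p * u φ p)
    (fun φ ψ => by
      rw [← integral_add (hi φ) (hi ψ)]
      simp only [u, timeFourier_add, mul_add])
    (fun c φ => by
      rw [RingHom.id_apply, smul_eq_mul, ← integral_const_mul]
      refine integral_congr_ae (Eventually.of_forall fun p => ?_)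
      simp only [u, timeFourier_smul]
      ring)
    ⟨Finset.Iic (4, 0), Real.pi * 2 ^ 4 * (K * (xNorm (-1) (-b) F).toReal), by positivity,
      fun φ => by
      have h1 := hK F hF (u φ) _ (by positivity) (hub φ)
      have h2 := (enorm_integral_le_lintegral_enorm (fun p => duhamelTime h F p * u φ p)).trans h1
      have h3 := ENNReal.toReal_mono (ENNReal.mul_ne_top
        (ENNReal.mul_ne_top ENNReal.ofReal_ne_top ENNReal.coe_ne_top) hF'.ne) h2
      rw [toReal_enorm, ENNReal.toReal_mul, ENNReal.toReal_mul,
        ENNReal.toReal_ofReal (by positivity), ENNReal.coe_toReal] at h3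
      refine h3.trans_eq ?_
      ring⟩
  refine ⟨ContinuousLinearMap.toPointwiseConvergenceCLM _ _ _ _
    ((2 * (Real.pi : ℂ))⁻¹ • V.comp timeBessel), fun φ => ?_⟩
  have e : (V.comp timeBessel) φ = ∫ p, duhamelTime h F p * u (timeBessel φ) p := rfl
  change (2 * (Real.pi : ℂ))⁻¹ • (V.comp timeBessel) φ = _
  rw [e, smul_eq_mul]
  simp only [u, ← timeFourier_eq_timeBessel]

lemma xNorm_mono (b : ℝ) {s s' : ℝ} (hs : s ≤ s') (F : ℝ × ℝ → ℂ) :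
    xNorm s b F ≤ xNorm s' b F := by
  refine eLpNorm_mono fun q => ?_
  have h1 := Real.rpow_nonneg (jb_nonneg (q.2 - q.1 ^ 3)) b
  have h2 := Real.rpow_nonneg (jb_nonneg q.1) s
  have h3 := Real.rpow_nonneg (jb_nonneg q.1) s'
  rw [Real.norm_of_nonneg (by positivity), Real.norm_of_nonneg (by positivity)]
  gcongr
  exact one_le_jb _

lemma xNorm_schwartz_lt_top {b : ℝ} (hb : 0 ≤ b) (M : 𝓢(ℝ × ℝ, ℂ)) :
    xNorm (-1) (-b) (fourier2 M) < ⊤ := by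
  obtain ⟨G, hG⟩ := exists_fourier2_schwartz M
  have hG2 : eLpNorm G 2 (volume : Measure (ℝ × ℝ)) < ⊤ := (G.memLp 2 volume).2
  refine lt_of_le_of_lt ?_ hG2
  rw [xNorm]
  refine eLpNorm_mono fun q => ?_
  have h1 : jb q.1 ^ (-1 : ℝ) ≤ 1 := Real.rpow_le_one_of_one_le_of_nonpos (one_le_jb _) (by norm_num)
  have h2 : jb (q.2 - q.1 ^ 3) ^ (-b) ≤ 1 :=
    Real.rpow_le_one_of_one_le_of_nonpos (one_le_jb _) (by linarith)
  have h3 := Real.rpow_nonneg (jb_nonneg q.1) (-1)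
  have h4 := Real.rpow_nonneg (jb_nonneg (q.2 - q.1 ^ 3)) (-b)
  rw [Real.norm_of_nonneg (by positivity), hG]
  exact mul_le_of_le_one_left (norm_nonneg _) (mul_le_one₀ h1 h4 h2)

lemma ae_duhamelMajorant_lt_top (h : 𝓢(ℝ, ℂ)) {b : ℝ} (hb : b < 1 / 2)
    {F : ℝ × ℝ → ℂ} (hF : AEStronglyMeasurable F volume) (hF' : xNorm (-1) (-b) F < ⊤) :
    ∀ᵐ υ : ℝ, duhamelMajorant h F υ < ⊤ := by
  obtain ⟨C, hC⟩ := exists_lintegral_duhamelMajorant_le h (s := -1) hb le_rfl (by linarith)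
  have h1 := hC F hF
  simp_rw [show (2 : ℝ) * ((-1 + 1) / 3) = 0 by norm_num, jbw_zero, one_mul] at h1
  have h2 : ∫⁻ υ, duhamelMajorant h F υ ^ 2 ≠ ⊤ :=
    (h1.trans_lt (ENNReal.mul_lt_top ENNReal.coe_lt_top (ENNReal.pow_lt_top hF'))).ne
  filter_upwards [ae_lt_top ((measurable_duhamelMajorant h hF).pow_const 2) h2] with υ hυ
  exact (ENNReal.pow_lt_top_iff.1 hυ).resolve_right two_ne_zero

lemma integrable_duhamelTime_integrand (h : 𝓢(ℝ, ℂ)) {F : ℝ × ℝ → ℂ}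
    (hF : AEStronglyMeasurable F volume) (p : ℝ × ℝ) (hp : duhamelMajorant h F p.2 < ⊤) :
    Integrable fun q : ℝ × ℝ =>
      Complex.exp (Complex.I * p.1 * q.1) * (duhamelSymbol h p.2 q * F q) := by
  refine ⟨?_, ?_⟩
  · refine AEStronglyMeasurable.mul (by fun_prop) (AEStronglyMeasurable.mul ?_ hF)
    exact Measurable.aestronglyMeasurable (by fun_prop)
  · refine lt_of_eq_of_lt (lintegral_congr fun q => ?_) hp
    rw [enorm_mul, enorm_mul, ← ofReal_norm, norm_exp_I_mul_ofReal_mul, ENNReal.ofReal_one,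
      one_mul]

/-- Linearity is asserted only almost everywhere, because the integral is known to converge
absolutely only at those υ where the majorant is finite. -/
lemma duhamelTime_sub_ae (h : 𝓢(ℝ, ℂ)) {b : ℝ} (hb : b < 1 / 2) {F G : ℝ × ℝ → ℂ}
    (hF : AEStronglyMeasurable F volume) (hF' : xNorm (-1) (-b) F < ⊤)
    (hG : AEStronglyMeasurable G volume) (hG' : xNorm (-1) (-b) G < ⊤) :
    ∀ᵐ p : ℝ × ℝ, duhamelTime h (fun q => F q - G q) p = duhamelTime h F p - duhamelTime h G p := by
  have h1 : ∀ᵐ p : ℝ × ℝ, duhamelMajorant h F p.2 < ⊤ :=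
    Measure.quasiMeasurePreserving_snd.ae (ae_duhamelMajorant_lt_top h hb hF hF')
  have h2 : ∀ᵐ p : ℝ × ℝ, duhamelMajorant h G p.2 < ⊤ :=
    Measure.quasiMeasurePreserving_snd.ae (ae_duhamelMajorant_lt_top h hb hG hG')
  filter_upwards [h1, h2] with p hp1 hp2
  rw [duhamelTime, duhamelTime, duhamelTime, ← mul_sub, ← integral_sub
    (integrable_duhamelTime_integrand h hF p hp1) (integrable_duhamelTime_integrand h hG p hp2)]
  simp only [mul_sub]

/-- Existence of the Duhamel term of an element of `X^{s,-b}`, with its time Fourier transform. -/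
theorem exists_isDuhamel {η : ℝ → ℝ} {h : 𝓢(ℝ, ℂ)} (hη : ∀ t, h t = η t) {s b : ℝ}
    (hb0 : 0 ≤ b) (hb : b < 1 / 2) (hs : -1 ≤ s) {F : ℝ × ℝ → ℂ}
    (hF : AEStronglyMeasurable F volume) (hF' : xNorm s (-b) F < ⊤) :
    ∃ U : 𝓢'(ℝ × ℝ, ℂ), IsDuhamel s (-b) η F U ∧ HasTimeFourier U (duhamelTime h F) := by
  have hF1 : xNorm (-1) (-b) F < ⊤ := (xNorm_mono (-b) hs F).trans_lt hF'
  obtain ⟨U, hU⟩ := exists_duhamel_distribution h hb hF hF1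
  refine ⟨U, ⟨exists_xTendsto s (-b) hF hF', fun M hM φ => ?_⟩,
    aestronglyMeasurable_duhamelTime h hF, fun φ =>
      ⟨integrable_duhamelTime_mul_timeFourier h hb hF hF1 φ, hU φ⟩⟩
  obtain ⟨K, hK⟩ := exists_lintegral_duhamelTime_mul_le h hb
  obtain ⟨C, hC, hφ⟩ := exists_norm_timeFourier_le φ
  have hMm (n : ℕ) : AEStronglyMeasurable (fourier2 (M n)) volume := by
    obtain ⟨G, hG⟩ := exists_fourier2_schwartz (M n)
    rw [← show (G : ℝ × ℝ → ℂ) = fourier2 (M n) from funext hG]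
    fun_prop
  have hi (n : ℕ) := integrable_duhamelTime_mul_timeFourier h hb (hMm n)
    (xNorm_schwartz_lt_top hb0 (M n)) φ
  have hiF := integrable_duhamelTime_mul_timeFourier h hb hF hF1 φ
  -- Parseval puts both sides in the same form, so by linearity their difference is the pairing for
  -- F minus the transform of M n, which is bounded by the norm at s = -1.
  simp_rw [fun n => integral_duhamel_mul hη (M n) φ (hi n), hU φ]
  refine Tendsto.const_mul _ ?_
  rw [tendsto_iff_edist_tendsto_0]
  have hlim : Tendsto (fun n => ENNReal.ofReal C * K *
      xNorm s (-b) (fun q => F q - fourier2 (M n) q)) atTop (𝓝 0) := by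
    have h1 := ENNReal.Tendsto.const_mul (a := ENNReal.ofReal C * K) hM
      (Or.inr (ENNReal.mul_ne_top ENNReal.ofReal_ne_top ENNReal.coe_ne_top))
    rwa [mul_zero] at h1
  refine tendsto_of_tendsto_of_tendsto_of_le_of_le tendsto_const_nhds hlim (fun _ => zero_le)
    fun n => ?_
  simp only
  rw [edist_comm, edist_eq_enorm_sub, ← integral_sub hiF (hi n)]
  refine (enorm_integral_le_lintegral_enorm _).trans ?_
  have h2 : ∫⁻ p, ‖duhamelTime h F p * timeFourier φ p -
      duhamelTime h (fourier2 (M n)) p * timeFourier φ p‖ₑ =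
      ∫⁻ p, ‖duhamelTime h (fun q => F q - fourier2 (M n) q) p * timeFourier φ p‖ₑ := by
    refine lintegral_congr_ae ?_
    filter_upwards [duhamelTime_sub_ae h hb hF hF1 (hMm n) (xNorm_schwartz_lt_top hb0 (M n))]
      with p hp
    rw [hp, sub_mul]
  rw [h2]
  refine (hK _ (hF.sub (hMm n)) _ C hC hφ).trans ?_
  gcongr
  exact xNorm_mono (-b) hs _

lemma linftyHNorm_le {σ : ℝ} {U : 𝓢'(ℝ × ℝ, ℂ)} {g : ℝ × ℝ → ℂ} (hg : HasTimeFourier U g)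
    {B : ℝ≥0∞} (hB : ∀ x, eLpNorm (fun τ : ℝ => jb τ ^ σ * ‖g (x, τ)‖) 2 volume ≤ B) :
    linftyHNorm σ U ≤ B :=
  (iInf₂_le g hg).trans (essSup_le_of_ae_le _ (Eventually.of_forall hB))

lemma exists_schwartz_cutoff {η : ℝ → ℝ} (hη : ContDiff ℝ ∞ η)
    (hη2 : tsupport η ⊆ Set.Icc (-2 : ℝ) 2) : ∃ h : 𝓢(ℝ, ℂ), ∀ t, h t = η t := by
  have hc : HasCompactSupport η :=
    isCompact_Icc.of_isClosed_subset (isClosed_tsupport η) hη2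
  have hc' : HasCompactSupport fun t => (η t : ℂ) := hc.comp_left (g := Complex.ofReal) rfl
  exact ⟨hc'.toSchwartzMap (Complex.ofRealCLM.contDiff.comp hη), fun t => rfl⟩

end AiryHalfLine

end

/-! ### The two estimates -/

theorem mainTheorem3 (b' : ℝ) (hb0 : 0 < b') (hb1 : b' < 1 / 2)
    (η : ℝ → ℝ) (hη : ContDiff ℝ ∞ η) (hη1 : ∀ t ∈ Set.Icc (-1 : ℝ) 1, η t = 1)
    (hη2 : tsupport η ⊆ Set.Icc (-2 : ℝ) 2) :
    (∀ s : ℝ, -1 ≤ s → s ≤ 2 - 3 * b' →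
      ∃ C : ℝ≥0, ∀ (N : 𝓢'(ℝ × ℝ, ℂ)) (F : ℝ × ℝ → ℂ),
        AiryHalfLine.HasFourier2 N F → AiryHalfLine.xNorm s (-b') F < ⊤ →
        ∃ U : 𝓢'(ℝ × ℝ, ℂ), AiryHalfLine.IsDuhamel s (-b') η F U ∧
          AiryHalfLine.linftyHNorm ((s + 1) / 3) U ≤ C * AiryHalfLine.xNorm s (-b') F) ∧
    (∀ s : ℝ, 2 - 3 * b' < s → ∀ K : ℝ, 1 < K →
      ∃ C : ℝ≥0, ∀ (N : 𝓢'(ℝ × ℝ, ℂ)) (F : ℝ × ℝ → ℂ),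
        AiryHalfLine.HasFourier2 N F → AiryHalfLine.xNorm s (-b') F < ⊤ →
        ∃ U : 𝓢'(ℝ × ℝ, ℂ), AiryHalfLine.IsDuhamel s (-b') η F U ∧
          AiryHalfLine.linftyHNorm ((s + 1) / 3) U ≤
            C * (AiryHalfLine.xNorm s (-b') F + AiryHalfLine.corrNorm K s F)) := by
  obtain ⟨h, hh⟩ := AiryHalfLine.exists_schwartz_cutoff hη hη2
  refine ⟨fun s hs hs' => ?_, fun s hs K hK => ?_⟩
  · obtain ⟨C, hC⟩ := AiryHalfLine.exists_lintegral_duhamelMajorant_le h hb1 hs hs'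
    refine ⟨NNReal.sqrt C, fun N F hN hF => ?_⟩
    obtain ⟨U, hU, hUg⟩ := AiryHalfLine.exists_isDuhamel hh hb0.le hb1 hs hN.1 hF
    exact ⟨U, hU, AiryHalfLine.linftyHNorm_le hUg fun x => AiryHalfLine.ennreal_le_of_sq_le
      ((AiryHalfLine.eLpNorm_duhamelTime_sq_le h F _ x).trans (hC F hN.1))⟩
  -- In fact s > 2-3b' > 1/2; nonnegativity is what the estimate outside the region uses.
  · have hs0 : 0 ≤ s := by linarith
    obtain ⟨C, hC⟩ := AiryHalfLine.exists_lintegral_duhamelMajorant_le_add h hb1 hs0 hK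
    refine ⟨NNReal.sqrt C, fun N F hN hF => ?_⟩
    obtain ⟨U, hU, hUg⟩ := AiryHalfLine.exists_isDuhamel hh hb0.le hb1 (by linarith) hN.1 hF
    exact ⟨U, hU, AiryHalfLine.linftyHNorm_le hUg fun x => AiryHalfLine.ennreal_le_of_sq_le
      ((AiryHalfLine.eLpNorm_duhamelTime_sq_le h F _ x).trans (hC F hN.1))⟩
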